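/- All percolation is Bernoulli bond percolation: for a graph $H$ and $p\in[0,1]$, each edge of $H$ is open with probability $p$, independently; clusters are the connected components of the open subgraph, and $p_c(H)=\inf\{p\in[0,1] : \text{a.s. there is an infinite cluster}\}$. (a) Let $\alpha\ge 2$, and let $T_1,T_2$ be two copies of the $(\alpha+1)$-regular tree, each with a distinguished end. The neighbour of a vertex towards the distinguished end is its parent; $v$ is a descendant of $u$ if $v=u$ or $u$ is reached from $v$ by passing repeatedly to the parent; levels are integers increasing by $1$ from parent to child. Let $\Gamma'_{\alpha,\alpha}$ be the graph on $V(T_1)\times V(T_2)$ in which $(u_1,u_2)$ and $(v_1,v_2)$ are adjacent if either $v_1$ is the parent of $u_1$ and $u_2$ is the parent of $v_2$, or $u_1$ is the parent of $v_1$ and $v_2$ is the parent of $u_2$. Fix a vertex $o=(o_1,o_2)$, let the Diestel–Leader graph $\Gamma_{\alpha,\alpha}$ be the connected component of $o$ in $\Gamma'_{\alpha,\alpha}$, and let its positive part $\Gamma^+_{\alpha,\alpha}$ be the subgraph induced by the vertices $(v_1,v_2)$ of $\Gamma_{\alpha,\alpha}$ such that $v_1$ is a descendant of $o_1$. Then $p_c(\Gamma_{\alpha,\alpha})\le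 p_c(\Gamma^+_{\alpha,\alpha})$, and almost surely percolation on $\Gamma^+_{\alpha,\alpha}$ at $p=p_c(\Gamma^+_{\alpha,\alpha})$ has no infinite cluster. The same holds for percolation on $\Gamma^+_{\alpha,\alpha}$ at $p=p_c(\Gamma_{\alpha,\alpha})$. Consequently, in percolation on $\Gamma_{\alpha,\alpha}$ at $p=p_c(\Gamma_{\alpha,\alpha})$, almost surely every infinite open simple path $(x_n)_{n\ge 0}$ crosses the level of $o$ infinitely often: with $\ell(v_1,v_2)$ denoting the level of $v_1$ in $T_1$, both $\ell(x_n)<\ell(o)$ and $\ell(x_n)>\ell(o)$ hold for infinitely many $n$. (b) Let $G$ be the Cayley graph of the lamplighter group, i.e. the set of pairs $(j,F)$ with $j\in\mathbb Z$ and $F\subset\mathbb Z$ finite, with the product $(j,F)(j',F')=(j+j',F\mathbin{\triangle}(j+F'))$, with respect to the generators $(0,\{0\})$ ("flip the current lamp") and $(\pm1,\emptyset)$ ("move one step"), where $x$ is joined to $xs$ for each generator $s$. Let $G^+$ be the subgraph induced by $\{(j,F): j\ge 0,\ F\subset\{0,1,2,\dots\}\}$. Then $p_c(G)\le p_c(G^+)$,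 and almost surely percolation on $G^+$ at $p=p_c(G^+)$ has no infinite cluster. -/

import Mathlib

open MeasureTheory ProbabilityTheory Filter

/-! ### Bernoulli bond percolation -/

namespace SimpleGraph

variable {V : Type*}

/-- The subgraph of open edges of `G` in the configuration `ω`. -/
def openGraph (G : SimpleGraph V) (ω : Set (Sym2 V)) : SimpleGraph V :=
  fromEdgeSet (G.edgeSet ∩ ω)

/-- The cluster of `v`: all vertices joined to `v` by an open path. -/
def cluster (G : SimpleGraph V) (ω : Set (Sym2 V)) (v : V) : Set V :=
  {w | (G.openGraph ω).Reachable v w}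

/-- Bernoulli(`p`) bond percolation on `G`: the law of a random set of edges that contains each edge
of `G` independently with probability `p`. -/
noncomputable def percolation (G : SimpleGraph V) (p : unitInterval) : Measure (Set (Sym2 V)) :=
  setBernoulli G.edgeSet p

/-- The critical probability: the infimum, in `[0, 1]`, of all `p` for which there is almost surely
an infinite cluster (it is `1` if there is no such `p`). -/
noncomputable def criticalProb (G : SimpleGraph V) : unitInterval :=
  sInf {p | ∀ᵐ ω ∂(G.percolation p), ∃ v, (G.cluster ω v).Infinite}

end SimpleGraph

/-! ### The regular tree with a distinguished end -/

/-- The vertices of the `(α + 1)`-regular tree with a distinguished end. The edges going down from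
each vertex to its `α` children are labelled by `Fin α` in such a way that every path towards the
distinguished end is eventually labelled `0`. A vertex is then given by its level `k` (increasing
away from the end) and by the labels `a 0, a 1, …` of the edges on its path upwards to the end. -/
abbrev TreeVertex (α : ℕ) [NeZero α] : Type := ℤ × (ℕ →₀ Fin α)

namespace TreeVertex

variable {α : ℕ} [NeZero α]

/-- The level of a vertex, which is one larger than the level of its parent. -/
def level (v : TreeVertex α) : ℤ := v.1

/-- The parent of a vertex: its neighbour in the direction of the distinguished end. -/
noncomputable def parent (v : TreeVertex α) : TreeVertex α :=
  (v.1 - 1, v.2.comapDomain Nat.succ Nat.succ_injective.injOn)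

/-- `v` is a descendant of `u` if the path upwards from `v` passes through `u` (possibly `v = u`). -/
def IsDescendant (v u : TreeVertex α) : Prop := ∃ n : ℕ, parent^[n] v = u

end TreeVertex

/-- The `(α + 1)`-regular tree: each vertex is joined to its parent. -/
def regularTree (α : ℕ) [NeZero α] : SimpleGraph (TreeVertex α) :=
  SimpleGraph.fromRel fun u v => u.parent = v

namespace TreeVertex

variable {α : ℕ} [NeZero α]

theorem level_parent (v : TreeVertex α) : v.parent.level = v.level - 1 := rfl

theorem level_iterate (n : ℕ) (v : TreeVertex α) : (parent^[n] v).level = v.level - n := by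
  induction n with
  | zero => simp
  | succ n ih =>
    rw [Function.iterate_succ_apply', level_parent, ih]
    push_cast
    ring

theorem labels_iterate (n k : ℕ) (v : TreeVertex α) : (parent^[n] v).2 k = v.2 (k + n) := by
  induction n generalizing k with
  | zero => rfl
  | succ n ih =>
    rw [Function.iterate_succ_apply']
    change (parent^[n] v).2 (k + 1) = _
    rw [ih]
    congr 1
    ring

theorem adj_parent (v : TreeVertex α) : (regularTree α).Adj v v.parent := by
  rw [regularTree, SimpleGraph.fromRel_adj]
  refine ⟨fun h => ?_, Or.inl rfl⟩
  have := congrArg level h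
  rw [level_parent] at this
  omega

theorem adj_iff (u v : TreeVertex α) :
    (regularTree α).Adj u v ↔ u.parent = v ∨ v.parent = u := by
  constructor
  · intro h
    exact ((SimpleGraph.fromRel_adj _ _ _).1 h).2
  · rintro (rfl | rfl)
    · exact adj_parent u
    · exact (adj_parent v).symm

/-- Any two upward paths merge, so that all of them represent the same end. -/
theorem exists_common_ancestor (u v : TreeVertex α) :
    ∃ m n : ℕ, parent^[m] u = parent^[n] v := by
  obtain ⟨M, hM⟩ : ∃ M : ℕ, ∀ k, M ≤ k → u.2 k = 0 ∧ v.2 k = 0 := by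
    refine ⟨(u.2.support ∪ v.2.support).sup id + 1, fun k hk => ?_⟩
    by_contra h
    have hk' : k ∈ u.2.support ∪ v.2.support := by
      rw [Finset.mem_union, Finsupp.mem_support_iff, Finsupp.mem_support_iff]
      tauto
    have := Finset.le_sup (f := id) hk'
    simp only [id] at this
    omega
  refine ⟨M + (u.level - v.level).toNat, M + (v.level - u.level).toNat, Prod.ext ?_ ?_⟩
  · have h1 := level_iterate (M + (u.level - v.level).toNat) u
    have h2 := level_iterate (M + (v.level - u.level).toNat) v
    simp only [level] at h1 h2 ⊢
    omega
  · ext k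
    rw [labels_iterate, labels_iterate, (hM _ (by omega)).1, (hM _ (by omega)).2]

theorem isTree_regularTree : (regularTree α).IsTree := by
  have hup : ∀ (n : ℕ) (v : TreeVertex α), (regularTree α).Reachable v (parent^[n] v) := by
    intro n v
    induction n with
    | zero => exact SimpleGraph.Reachable.refl _
    | succ n ih =>
      rw [Function.iterate_succ_apply']
      exact ih.trans (adj_parent _).reachable
  have hcut : ∀ v : TreeVertex α, (regularTree α).IsBridge s(v, v.parent) := by
    intro v
    rw [SimpleGraph.isBridge_iff]
    have key : ∀ x y, ((regularTree α).deleteEdges {s(v, v.parent)}).Adj x y →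
        x.IsDescendant v → y.IsDescendant v := by
      rintro x y hxy ⟨n, hn⟩
      rw [SimpleGraph.deleteEdges_adj, adj_iff] at hxy
      obtain ⟨rfl | rfl, hne⟩ := hxy
      · cases n with
        | zero =>
          have hx : x = v := hn
          exact absurd (by rw [hx]; rfl) hne
        | succ n => exact ⟨n, by rw [← hn, Function.iterate_succ_apply]⟩
      · exact ⟨n + 1, by rw [Function.iterate_succ_apply, hn]⟩
    rintro ⟨w⟩
    have hw : ∀ x y, ((regularTree α).deleteEdges {s(v, v.parent)}).Walk x y →
        x.IsDescendant v → y.IsDescendant v := by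
      intro x y w
      induction w with
      | nil => exact id
      | cons h _ ih => exact fun hx => ih (key _ _ h hx)
    obtain ⟨n, hn⟩ := hw _ _ w ⟨0, rfl⟩
    have h1 := level_iterate n v.parent
    rw [hn, level_parent] at h1
    omega
  refine { preconnected := fun u v => ?_, nonempty := ⟨0⟩, isAcyclic := ?_ }
  · obtain ⟨m, n, h⟩ := exists_common_ancestor u v
    exact (hup m u).trans (h ▸ (hup n v).symm)
  · rw [SimpleGraph.isAcyclic_iff_forall_adj_isBridge]
    intro u v h
    rcases (adj_iff u v).1 h with rfl | rfl
    · exact hcut u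
    · rw [Sym2.eq_swap]
      exact hcut v

theorem ncard_children (u : TreeVertex α) : {v : TreeVertex α | v.parent = u}.ncard = α := by
  have hf : ∀ (v : TreeVertex α) (k : ℕ), v.parent.2 k = v.2 (k + 1) := fun _ _ => rfl
  let e : {v : TreeVertex α | v.parent = u} ≃ Fin α :=
    Equiv.ofBijective (fun v => v.1.2 0) (by
      constructor
      · rintro ⟨v, hv⟩ ⟨w, hw⟩ h
        have hvw : v.parent = w.parent := Eq.trans hv (Eq.symm hw)
        refine Subtype.ext (Prod.ext ?_ ?_)
        · have := congrArg level hvw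
          rw [level_parent, level_parent] at this
          simp only [level] at this
          change v.1 = w.1
          omega
        · ext k
          cases k with
          | zero => exact congrArg Fin.val h
          | succ k => rw [← hf, ← hf, hvw]
      · intro c
        let f : ℕ →₀ Fin α :=
          (Finsupp.embDomain ⟨Nat.succ, Nat.succ_injective⟩ u.2).update 0 c
        refine ⟨⟨(u.1 + 1, f), Prod.ext ?_ ?_⟩, ?_⟩
        · change u.1 + 1 - 1 = u.1
          ring
        · ext k
          rw [hf]
          simp only [f, Finsupp.update_apply, Nat.add_eq_zero_iff, one_ne_zero, and_false, if_false]
          exact congrArg Fin.val (Finsupp.embDomain_apply_self _ u.2 k)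
        · simp [f, Finsupp.update_apply])
  rw [← Nat.card_coe_set_eq, Nat.card_congr e, Nat.card_eq_fintype_card, Fintype.card_fin]

theorem ncard_neighborSet (u : TreeVertex α) :
    ((regularTree α).neighborSet u).ncard = α + 1 := by
  have h : (regularTree α).neighborSet u = insert u.parent {v | v.parent = u} := by
    ext v
    simp only [SimpleGraph.mem_neighborSet, adj_iff, Set.mem_insert_iff, Set.mem_ofPred_eq,
      eq_comm (a := v)]
  have hfin : {v : TreeVertex α | v.parent = u}.Finite :=
    Set.finite_of_ncard_ne_zero (by rw [ncard_children]; exact NeZero.ne α)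
  rw [h, Set.ncard_insert_of_notMem _ hfin, ncard_children]
  intro h'
  have := congrArg level (show u.parent.parent = u from h')
  rw [level_parent, level_parent] at this
  omega

end TreeVertex

/-! ### Diestel–Leader graphs -/

/-- The graph `Γ'_{α,β}` on pairs of vertices of the two trees: along an edge, one moves
simultaneously along an edge of each of the trees, towards the distinguished end in one of them and
away from it in the other. -/
def dlProduct (α β : ℕ) [NeZero α] [NeZero β] :
    SimpleGraph (TreeVertex α × TreeVertex β) :=
  SimpleGraph.fromRel fun x y => x.1.parent = y.1 ∧ x.2 = y.2.parent

/-- The vertices of the connected component of `o` in `Γ'_{α,β}`. -/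
abbrev DLVertex {α β : ℕ} [NeZero α] [NeZero β] (o : TreeVertex α × TreeVertex β) : Type :=
  ((dlProduct α β).connectedComponentMk o)

/-- The Diestel–Leader graph `Γ_{α,β}`, as the connected component of `o` in `Γ'_{α,β}`. -/
def diestelLeader {α β : ℕ} [NeZero α] [NeZero β] (o : TreeVertex α × TreeVertex β) :
    SimpleGraph (DLVertex o) :=
  ((dlProduct α β).connectedComponentMk o).toSimpleGraph

/-- The level of a vertex of `Γ_{α,β}` is the level of its first coordinate. -/
def DLVertex.level {α β : ℕ} [NeZero α] [NeZero β] {o : TreeVertex α × TreeVertex β}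
    (v : DLVertex o) : ℤ := v.1.1.level

/-- The vertices of `Γ_{α,β}` whose first coordinate is a descendant of the first coordinate
of `o`. -/
def dlPositiveSet {α β : ℕ} [NeZero α] [NeZero β] (o : TreeVertex α × TreeVertex β) :
    Set (DLVertex o) :=
  {v | v.1.1.IsDescendant o.1}

/-- The positive part of `Γ_{α,β}` with respect to the vertex `o`. -/
def dlPositivePart {α β : ℕ} [NeZero α] [NeZero β] (o : TreeVertex α × TreeVertex β) :
    SimpleGraph (dlPositiveSet o) :=
  (diestelLeader o).induce (dlPositiveSet o)

/-! ### The lamplighter group -/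

/-- An element `(j, F)` of the lamplighter group: `j` is the position of the lamplighter and `F` is
the finite set of lamps that are lit. -/
@[ext]
structure LamplighterGroup where
  /-- The position of the lamplighter. -/
  pos : ℤ
  /-- The set of lamps that are lit. -/
  lamps : Finset ℤ

namespace LamplighterGroup

/-- The group law is `(j, F) * (j', F') = (j + j', F ∆ (j + F'))`. -/
instance : Mul LamplighterGroup where
  mul x y := ⟨x.pos + y.pos, symmDiff x.lamps (y.lamps.map (addLeftEmbedding x.pos))⟩

instance : One LamplighterGroup where
  one := ⟨0, ∅⟩

instance : Inv LamplighterGroup where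
  inv x := ⟨-x.pos, x.lamps.map (addLeftEmbedding (-x.pos))⟩

theorem mul_def (x y : LamplighterGroup) : x * y =
    ⟨x.pos + y.pos, symmDiff x.lamps (y.lamps.map (addLeftEmbedding x.pos))⟩ := rfl

theorem one_def : (1 : LamplighterGroup) = ⟨0, ∅⟩ := rfl

theorem inv_def (x : LamplighterGroup) :
    x⁻¹ = ⟨-x.pos, x.lamps.map (addLeftEmbedding (-x.pos))⟩ := rfl

theorem mem_map_addLeft (j k : ℤ) (F : Finset ℤ) :
    k ∈ F.map (addLeftEmbedding j) ↔ k - j ∈ F := by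
  simp only [Finset.mem_map, addLeftEmbedding_apply]
  constructor
  · rintro ⟨a, ha, rfl⟩
    simpa using ha
  · intro h
    exact ⟨k - j, h, by ring⟩

instance : Group LamplighterGroup :=
  Group.ofLeftAxioms
    (by
      intro x y z
      simp only [mul_def]
      ext1
      · simp [add_assoc]
      · ext k
        simp only [Finset.mem_symmDiff, mem_map_addLeft, ← sub_sub]
        tauto)
    (by
      intro x
      simp only [mul_def, one_def]
      ext1
      · simp
      · ext k
        simp [Finset.mem_symmDiff])
    (by
      intro x
      simp only [mul_def, one_def, inv_def]
      ext1
      · simp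
      · simp)

/-- The Cayley graph of the lamplighter group with generators `(0, {0})` (flip the current lamp)
and `(±1, ∅)` (move one step). -/
def cayleyGraph : SimpleGraph LamplighterGroup :=
  SimpleGraph.mulCayley {⟨0, {0}⟩, ⟨1, ∅⟩, ⟨-1, ∅⟩}

/-- The elements `(j, F)` with `j ≥ 0` and `F ⊆ {0, 1, 2, …}`. -/
def positiveSet : Set LamplighterGroup := {x | 0 ≤ x.pos ∧ ∀ k ∈ x.lamps, 0 ≤ k}

/-- The positive half of the Cayley graph. -/
def positiveHalf : SimpleGraph positiveSet := cayleyGraph.induce positiveSet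

end LamplighterGroup

/-!
The positive part of the Diestel–Leader graph and the positive half of the lamplighter group are
both instances of one self-similar graph, `lampGraph R`: a vertex is a position `j : ℕ` together
with a finitely supported configuration of lamps on `ℕ`, and an edge at site `s` joins positions
among `s`, `s + 1` and changes at most the lamp at `s`. For a Diestel–Leader graph, the lamps below
`j` are the labels of the path upwards in the first tree, the lamps from `j` on those of the path
upwards in the second tree. The theorem follows from the fact that the set of all `p` at which the
lamp graph percolates is open and does not contain `0`: then its infimum `p_c` does not belong
to it.

Start at the root `(0, 0)` and use only open edges inside the finite box of the positions up to `n`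
and of the configurations supported below `n`. Its vertices at position `n`, the exits, have
distinct states on the first `n` lamps. From each exit starts a copy of the whole lamp graph, in
which those lamps are frozen (`lampGraph.shift`), and these copies have no edge in common with each
other or with the box. Hence percolation contains a branching process, whose offspring mean is the
expected number `meanExits R n p` of exits that are reached. Percolation at `p` is equivalent to
`1 < meanExits R n p` for some `n`, which is an open condition as `meanExits R n` is a polynomial.

* If the mean is larger than `1`, the branching process survives
  (`rootInfinite_pos_of_one_lt_meanExits`). A second-moment bound for one generation suffices.
* If `p < 1` and the cluster of the root can be infinite, then the number of exits reached exceeds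
  any `K` with non-vanishing probability as `n → ∞`, since from at most `K` exits the cluster is
  stopped with a probability bounded below, which can happen for one `n` only. So some mean is
  larger than `1` (`exists_one_lt_meanExits_of_lt_one`). At `p = 1`, already `n = 1` will do.
* Opening a single edge passes from an infinite cluster somewhere to one at the root
  (`SimpleGraph.infinite_cluster_pos_of_not_ae_finite`), and two disjoint copies inside the lamp
  graph give a zero–one law (`ae_exists_infinite_cluster`).

As for the paths in the Diestel–Leader graph, a path that visits levels below that of `o` only
finitely often stays, from the time on at which it attains the lowest level that it still visits, in
the positive part with respect to the vertex where it is then. All these positive parts are lamp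
graphs, and there are countably many of them, so that almost surely none has an infinite cluster at
`p_c`. Exchanging the two trees deals with the levels above.
-/

/-! ### Bernoulli random subsets -/

section Bernoulli

variable {ι κ : Type*}

theorem measurable_mem_set (i : ι) : Measurable fun ω : Set ι => i ∈ ω :=
  measurable_set_mem i

theorem measurable_preimage_set (f : κ → ι) : Measurable fun ω : Set ι => f ⁻¹' ω :=
  measurable_set_iff.2 fun k => measurable_mem_set (f k)

/-- A Bernoulli random set, pulled back along an injection, is again a Bernoulli random set. -/
theorem map_preimage_setBernoulli {f : κ → ι} (hf : Function.Injective f) (u : Set ι)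
    (p : unitInterval) :
    (setBernoulli u p).map (fun ω => f ⁻¹' ω) = setBernoulli (f ⁻¹' u) p := by
  have hm : Measurable fun P : ι → Prop => {i | P i} := by fun_prop
  have hm' : Measurable fun P : κ → Prop => {i | P i} := by fun_prop
  rw [setBernoulli_eq_map, setBernoulli_eq_map, Measure.map_map (measurable_preimage_set f) hm]
  have h := Measure.map_infinitePi_infinitePi_of_inj
    (P := fun i : ι ↦ unitInterval.toNNReal p • Measure.dirac (i ∈ u) +
      unitInterval.toNNReal (unitInterval.symm p) • Measure.dirac False) hf
  simp only [Set.mem_preimage]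
  rw [← h, Measure.map_map hm' (by fun_prop)]
  rfl

theorem measurePreserving_preimage_setBernoulli {f : κ → ι} (hf : Function.Injective f)
    (u : Set ι) (p : unitInterval) :
    MeasurePreserving (fun ω => f ⁻¹' ω) (setBernoulli u p) (setBernoulli (f ⁻¹' u) p) :=
  ⟨measurable_preimage_set f, map_preimage_setBernoulli hf u p⟩

theorem iIndepFun_mem_setBernoulli (u : Set ι) (p : unitInterval) :
    iIndepFun (fun i (ω : Set ι) => i ∈ ω) (setBernoulli u p) := by
  rw [iIndepFun_iff_map_fun_eq_infinitePi_map measurable_mem_set]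
  have hm : Measurable fun P : ι → Prop => {i | P i} := by fun_prop
  have hm' : Measurable fun (ω : Set ι) (i : ι) => i ∈ ω :=
    measurable_pi_iff.2 measurable_mem_set
  rw [setBernoulli_eq_map, Measure.map_map hm' hm]
  have h : ((fun (ω : Set ι) i => i ∈ ω) ∘ fun P : ι → Prop => {i | P i}) = id := by
    funext P i
    rfl
  rw [h, Measure.map_id]
  congr 1
  funext i
  rw [Measure.map_map (measurable_mem_set i) hm]
  exact (Measure.infinitePi_map_eval (fun i : ι ↦ unitInterval.toNNReal p • Measure.dirac (i ∈ u) +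
      unitInterval.toNNReal (unitInterval.symm p) • Measure.dirac False) i).symm

/-- Two events that are determined by disjoint sets of coordinates are independent. -/
theorem setBernoulli_real_inter {u : Set ι} {p : unitInterval} {S T : Set ι} (hST : Disjoint S T)
    {A B : Set (Set ι)} (hA : MeasurableSet A) (hB : MeasurableSet B)
    (hAS : ∀ ω, ω ∩ S ∈ A ↔ ω ∈ A) (hBT : ∀ ω, ω ∩ T ∈ B ↔ ω ∈ B) :
    (setBernoulli u p).real (A ∩ B) = (setBernoulli u p).real A * (setBernoulli u p).real B := by
  have key : ∀ (S : Set ι) (A : Set (Set ι)), MeasurableSet A → (∀ ω, ω ∩ S ∈ A ↔ ω ∈ A) →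
      MeasurableSet[⨆ i ∈ S, MeasurableSpace.comap (fun ω : Set ι => i ∈ ω) ⊤] A := by
    intro S A hA hAS
    have hpre : (fun ω : Set ι => ω ∩ S) ⁻¹' A = A := Set.ext hAS
    rw [← hpre]
    have hmeas : Measurable[⨆ i ∈ S, MeasurableSpace.comap (fun ω : Set ι => i ∈ ω) ⊤]
        fun ω : Set ι => ω ∩ S := by
      refine @measurable_set_iff _ _ (_) _ |>.2 fun i => ?_
      by_cases hi : i ∈ S
      · simp only [Set.mem_inter_iff, hi, and_true]
        exact (comap_measurable _).mono (le_iSup₂_of_le i hi le_rfl) le_rfl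
      · simp only [Set.mem_inter_iff, hi, and_false]
        exact measurable_const
    exact hmeas hA
  have hind := indep_iSup_of_disjoint (fun i => (measurable_mem_set i).comap_le)
    (iIndepFun_mem_setBernoulli u p) hST
  have h := (Indep_iff _ _ _).1 hind A B (key S A hA hAS) (key T B hB hBT)
  rw [measureReal_def, h, ENNReal.toReal_mul]
  rfl

/-- The probability of an event that is determined by finitely many coordinates is a polynomial
in the parameter. -/
theorem continuous_setBernoulli_real (u : Set ι) {T : Set ι} (hT : T.Finite)
    {A : Set (Set ι)} (hAT : ∀ ω, ω ∩ T ∈ A ↔ ω ∈ A) :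
    Continuous fun p => (setBernoulli u p).real A := by
  classical
  have := hT.to_subtype
  have := Fintype.ofFinite T
  let f : T → ι := Subtype.val
  let A' : Finset (Set T) := Set.toFinset {s | f '' s ∈ A}
  have hpre : (fun ω : Set ι => f ⁻¹' ω) ⁻¹' (A' : Set (Set T)) = A := by
    ext ω
    simp only [A', Set.coe_toFinset, Set.mem_preimage, Set.mem_ofPred_eq, f]
    rw [Subtype.image_preimage_coe, Set.inter_comm]
    exact hAT ω
  have hreal : ∀ p, (setBernoulli u p).real A =
      ∑ s ∈ A', (setBernoulli (f ⁻¹' u) p).real {s} := by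
    intro p
    rw [sum_measureReal_singleton, ← hpre]
    exact (measurePreserving_preimage_setBernoulli Subtype.val_injective u p).measureReal_preimage
      A'.measurableSet.nullMeasurableSet
  simp_rw [hreal]
  refine continuous_finsetSum _ fun s _ => ?_
  by_cases hs : s ⊆ f ⁻¹' u
  · simp_rw [setBernoulli_real_singleton _ hs (Set.toFinite _)]
    fun_prop
  · simp_rw [measureReal_def, setBernoulli_singleton_of_not_subset _ hs]
    exact continuous_const

theorem pow_card_le_setBernoulli_real_forall_notMem [Finite κ] (u : Set ι) (p : unitInterval)
    (e : κ → ι) :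
    (1 - p : ℝ) ^ Nat.card κ ≤ (setBernoulli u p).real {ω | ∀ k, e k ∉ ω} := by
  let f : Set.range e → ι := Subtype.val
  have hpre : (fun ω : Set ι => f ⁻¹' ω) ⁻¹' {∅} = {ω | ∀ k, e k ∉ ω} := by
    ext ω
    simp [f, Set.eq_empty_iff_forall_notMem]
  rw [← hpre, (measurePreserving_preimage_setBernoulli Subtype.val_injective
      u p).measureReal_preimage (MeasurableSet.singleton _).nullMeasurableSet,
    setBernoulli_real_singleton _ (Set.empty_subset _) (Set.toFinite _)]
  simp only [Set.ncard_empty, pow_zero, one_mul]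
  have h1 : (0 : ℝ) ≤ 1 - p := sub_nonneg.2 p.2.2
  refine pow_le_pow_of_le_one h1 (by linarith [p.2.1]) ?_
  calc _ ≤ Nat.card (Set.range e) := by
        rw [← Set.ncard_univ]
        exact Set.ncard_le_ncard (Set.subset_univ _) (Set.toFinite _)
    _ ≤ Nat.card κ := Finite.card_range_le e

theorem setBernoulli_real_mem {u : Set ι} (p : unitInterval) {i : ι} (hi : i ∈ u) :
    (setBernoulli u p).real {ω | i ∈ ω} = p := by
  let f : Unit → ι := fun _ => i
  have hpre : (fun ω : Set ι => f ⁻¹' ω) ⁻¹' {Set.univ} = {ω | i ∈ ω} := by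
    ext ω
    simp [f, Set.eq_univ_iff_forall]
  have hu : f ⁻¹' u = Set.univ := Set.eq_univ_of_forall fun _ => hi
  rw [← hpre, (measurePreserving_preimage_setBernoulli (Function.injective_of_subsingleton f)
      u p).measureReal_preimage (MeasurableSet.singleton _).nullMeasurableSet,
    setBernoulli_real_singleton _ (by rw [hu]) (Set.toFinite _), hu]
  simp

/-- A thinned second-order Bonferroni inequality. The parameter `t` makes the lower bound usable
even if the events `A i` are too likely for the inequality with `t = 1`. -/
theorem sum_sub_sum_le_measureReal_iUnion [Fintype κ] {Ω : Type*} [MeasurableSpace Ω]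
    (μ : Measure Ω) [IsProbabilityMeasure μ] {A : κ → Set Ω}
    (hA : ∀ i, MeasurableSet (A i)) {t : ℝ} (ht0 : 0 ≤ t) (ht1 : t ≤ 1) {c : ℝ}
    (hc : ∀ i j, i ≠ j → μ.real (A i ∩ A j) ≤ c) (hc0 : 0 ≤ c) :
    t * ∑ i, μ.real (A i) - t ^ 2 * (Fintype.card κ ^ 2 * c) ≤ μ.real (⋃ i, A i) := by
  classical
  let I : Set Ω → Ω → ℝ := fun s => s.indicator 1
  have hI : ∀ s : Set Ω, MeasurableSet s → Integrable (I s) μ := fun s hs =>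
    (integrable_const (1 : ℝ)).indicator hs
  have hII : ∀ s : Set Ω, MeasurableSet s → ∫ x, I s x ∂μ = μ.real s := fun s hs =>
    integral_indicator_one hs
  -- With `X` the number of the events that occur, this says `t * X - t ^ 2 * (X ^ 2 - X) ≤ 1`, and
  -- the left-hand side is at most `(1 + t) ^ 2 / 4`.
  have hpt : ∀ x, t * ∑ i, I (A i) x -
      t ^ 2 * ∑ q ∈ Finset.univ.filter (fun q : κ × κ => q.1 ≠ q.2), I (A q.1 ∩ A q.2) x ≤
      I (⋃ i, A i) x := by
    intro x
    have hsq : (∑ i, I (A i) x) ^ 2 = ∑ i, I (A i) x +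
        ∑ q ∈ Finset.univ.filter (fun q : κ × κ => q.1 ≠ q.2), I (A q.1 ∩ A q.2) x := by
      rw [sq, Finset.sum_mul_sum, ← Finset.univ_product_univ, ← Finset.sum_product',
        ← Finset.sum_filter_add_sum_filter_not _ (fun q : κ × κ => q.1 = q.2)]
      congr 1
      · rw [Finset.univ_product_univ, Finset.sum_filter, Fintype.sum_prod_type]
        refine Finset.sum_congr rfl fun i _ => ?_
        by_cases hi : x ∈ A i <;> simp [I, hi]
      · refine Finset.sum_congr (by simp) fun q _ => ?_
        by_cases h1 : x ∈ A q.1 <;> by_cases h2 : x ∈ A q.2 <;> simp [I, h1, h2]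
    set X := ∑ i, I (A i) x with hX
    set Y := ∑ q ∈ Finset.univ.filter (fun q : κ × κ => q.1 ≠ q.2), I (A q.1 ∩ A q.2) x
    by_cases hx : x ∈ ⋃ i, A i
    · have : I (⋃ i, A i) x = 1 := by simp [I, Set.indicator_of_mem hx]
      rw [this]
      have hY : Y = X ^ 2 - X := by linarith
      rw [hY]
      nlinarith [sq_nonneg (t * X - (1 + t) / 2), sq_nonneg (1 - t)]
    · have h0 : ∀ i, x ∉ A i := by simpa using hx
      have hX0 : X = 0 := Finset.sum_eq_zero fun i _ => by simp [I, h0 i]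
      have hY0 : Y = 0 := Finset.sum_eq_zero fun q _ => by simp [I, h0]
      rw [hX0, hY0]
      simp [I, hx]
  have hint1 : Integrable (fun x => t * ∑ i, I (A i) x) μ :=
    (integrable_finsetSum _ fun i _ => hI _ (hA i)).const_mul t
  have hint2 : Integrable (fun x => t ^ 2 *
      ∑ q ∈ Finset.univ.filter (fun q : κ × κ => q.1 ≠ q.2), I (A q.1 ∩ A q.2) x) μ :=
    (integrable_finsetSum _ fun q _ => hI _ ((hA q.1).inter (hA q.2))).const_mul _
  have h := integral_mono (hint1.sub hint2) (hI _ (MeasurableSet.iUnion hA)) hpt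
  rw [hII _ (MeasurableSet.iUnion hA)] at h
  simp only [Pi.sub_apply] at h
  rw [integral_sub hint1 hint2, integral_const_mul, integral_const_mul,
    integral_finsetSum _ fun i _ => hI _ (hA i),
    integral_finsetSum _ fun q _ => hI _ ((hA q.1).inter (hA q.2))] at h
  simp_rw [hII _ (hA _)] at h
  have hle : ∑ q ∈ Finset.univ.filter (fun q : κ × κ => q.1 ≠ q.2),
      ∫ x, I (A q.1 ∩ A q.2) x ∂μ ≤ Fintype.card κ ^ 2 * c := by
    calc _ ≤ ∑ q ∈ Finset.univ.filter (fun q : κ × κ => q.1 ≠ q.2), c :=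
          Finset.sum_le_sum fun q hq => by
            rw [hII _ ((hA q.1).inter (hA q.2))]
            exact hc _ _ (by simpa using hq)
      _ ≤ ∑ q : κ × κ, c :=
          Finset.sum_le_sum_of_subset_of_nonneg (Finset.filter_subset _ _) fun _ _ _ => hc0
      _ = Fintype.card κ ^ 2 * c := by simp [sq]
  nlinarith [mul_le_mul_of_nonneg_left hle (sq_nonneg t)]

end Bernoulli

/-! ### Percolation on general graphs -/

namespace SimpleGraph

variable {V W : Type*} {G : SimpleGraph V} {H : SimpleGraph W}

theorem openGraph_adj {ω : Set (Sym2 V)} {x y : V} :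
    (G.openGraph ω).Adj x y ↔ G.Adj x y ∧ s(x, y) ∈ ω := by
  rw [openGraph, fromEdgeSet_adj, Set.mem_inter_iff, mem_edgeSet]
  exact ⟨fun h => h.1, fun h => ⟨h, h.1.ne⟩⟩

theorem openGraph_mono {ω ω' : Set (Sym2 V)} (h : G.edgeSet ∩ ω ⊆ ω') :
    G.openGraph ω ≤ G.openGraph ω' := fun _ _ hxy => by
  rw [openGraph_adj] at hxy ⊢
  exact ⟨hxy.1, h hxy⟩

theorem openGraph_le_openGraph {H : SimpleGraph V} (h : G ≤ H) (ω : Set (Sym2 V)) :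
    G.openGraph ω ≤ H.openGraph ω := fun _ _ hxy => by
  rw [openGraph_adj] at hxy ⊢
  exact ⟨h hxy.1, hxy.2⟩

theorem openGraph_inter_edgeSet (ω : Set (Sym2 V)) :
    G.openGraph (ω ∩ G.edgeSet) = G.openGraph ω :=
  le_antisymm (openGraph_mono fun _ h => h.2.1) (openGraph_mono fun _ h => ⟨h.2, h.1⟩)

theorem mem_cluster {ω : Set (Sym2 V)} {v w : V} :
    w ∈ G.cluster ω v ↔ (G.openGraph ω).Reachable v w := Iff.rfl

theorem cluster_eq_of_reachable {ω : Set (Sym2 V)} {v w : V}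
    (h : (G.openGraph ω).Reachable v w) : G.cluster ω v = G.cluster ω w :=
  Set.ext fun _ => ⟨fun hx => h.symm.trans hx, fun hx => h.trans hx⟩

theorem reachable_openGraph_iff_exists_finset {ω : Set (Sym2 V)} {v w : V} :
    (G.openGraph ω).Reachable v w ↔
      ∃ T : Finset (Sym2 V), (G.openGraph T).Reachable v w ∧ (T : Set (Sym2 V)) ⊆ ω := by
  classical
  constructor
  · rintro ⟨q⟩
    induction q with
    | nil => exact ⟨∅, Reachable.refl _, by simp⟩
    | @cons a b c h _ ih =>
      obtain ⟨T, hT, hTω⟩ := ih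
      rw [openGraph_adj] at h
      refine ⟨insert s(a, b) T, ?_, ?_⟩
      · have h1 : (G.openGraph (insert s(a, b) T : Finset (Sym2 V))).Adj a b :=
          openGraph_adj.2 ⟨h.1, by simp⟩
        refine h1.reachable.trans (hT.mono (openGraph_mono fun e he => ?_))
        simpa using Or.inr he.2
      · rw [Finset.coe_insert]
        exact Set.insert_subset h.2 hTω
  · rintro ⟨T, hT, hTω⟩
    exact hT.mono (openGraph_mono fun e he => hTω he.2)

section Measurability

variable [Countable V]

theorem measurableSet_reachable (G : SimpleGraph V) (v w : V) :
    MeasurableSet {ω | (G.openGraph ω).Reachable v w} := by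
  have heq : {ω | (G.openGraph ω).Reachable v w} = ⋃ T : Finset (Sym2 V),
      {ω | (G.openGraph (T : Set (Sym2 V))).Reachable v w ∧ (T : Set (Sym2 V)) ⊆ ω} := by
    ext ω
    rw [Set.mem_iUnion]
    exact reachable_openGraph_iff_exists_finset
  rw [heq]
  refine .iUnion fun T => ?_
  by_cases h : (G.openGraph (T : Set (Sym2 V))).Reachable v w
  · simp only [h, true_and]
    have : {ω : Set (Sym2 V) | (T : Set (Sym2 V)) ⊆ ω} = ⋂ e ∈ T, {ω | e ∈ ω} := by
      ext ω
      simp [Set.subset_def]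
    rw [this]
    exact .biInter (Finset.countable_toSet T) fun e _ => (measurable_mem_set e).setOf
  · simp [h]

theorem measurableSet_infinite_cluster (G : SimpleGraph V) (v : V) :
    MeasurableSet {ω | (G.cluster ω v).Infinite} := by
  have h : {ω | (G.cluster ω v).Infinite} =
      ⋂ F : Finset V, ⋃ w : {w // w ∉ F}, {ω | (G.openGraph ω).Reachable v w} := by
    ext ω
    simp only [Set.mem_ofPred_eq, Set.mem_iInter, Set.mem_iUnion]
    constructor
    · intro hinf F
      obtain ⟨w, hw, hwF⟩ := hinf.exists_notMem_finset F
      exact ⟨⟨w, hwF⟩, hw⟩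
    · intro h hfin
      obtain ⟨⟨w, hwF⟩, hw⟩ := h hfin.toFinset
      exact hwF (hfin.mem_toFinset.2 hw)
  rw [h]
  exact .iInter fun F => .iUnion fun w => G.measurableSet_reachable v w

theorem measurableSet_exists_infinite_cluster (G : SimpleGraph V) :
    MeasurableSet {ω | ∃ v, (G.cluster ω v).Infinite} := by
  rw [Set.ofPred_exists]
  exact .iUnion fun v => G.measurableSet_infinite_cluster v

end Measurability

instance (G : SimpleGraph V) (p : unitInterval) : IsProbabilityMeasure (G.percolation p) :=
  inferInstanceAs (IsProbabilityMeasure (setBernoulli G.edgeSet p))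

/-- Percolation on `G`, restricted to the image of an induced subgraph `H`, is percolation
on `H`. -/
theorem measurePreserving_percolation (f : H ↪g G) (p : unitInterval) :
    MeasurePreserving (fun ω : Set (Sym2 V) => Sym2.map f ⁻¹' ω) (G.percolation p)
      (H.percolation p) := by
  have h := measurePreserving_preimage_setBernoulli (Sym2.map.injective f.injective) G.edgeSet p
  have he : Sym2.map f ⁻¹' G.edgeSet = H.edgeSet := by
    ext e
    induction e with
    | _ x y => simp
  rw [he] at h
  exact h

theorem openGraph_adj_map (f : H ↪g G) {ω : Set (Sym2 V)} {x y : W} :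
    (G.openGraph ω).Adj (f x) (f y) ↔ (H.openGraph (Sym2.map f ⁻¹' ω)).Adj x y := by
  simp [openGraph_adj, f.map_adj_iff]

theorem reachable_openGraph_map (f : H ↪g G) {ω : Set (Sym2 V)} {v w : W}
    (h : (H.openGraph (Sym2.map f ⁻¹' ω)).Reachable v w) :
    (G.openGraph ω).Reachable (f v) (f w) :=
  h.map ⟨f, fun h => (openGraph_adj_map f).2 h⟩

theorem infinite_cluster_map (f : H ↪g G) {ω : Set (Sym2 V)} {v : W}
    (h : (H.cluster (Sym2.map f ⁻¹' ω) v).Infinite) : (G.cluster ω (f v)).Infinite :=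
  (h.image f.injective.injOn).mono (by
    rintro _ ⟨w, hw, rfl⟩
    exact reachable_openGraph_map f hw)

theorem criticalProb_le_of_embedding (f : H ↪g G) : G.criticalProb ≤ H.criticalProb := by
  refine sInf_le_sInf fun p hp => ?_
  have h := (measurePreserving_percolation f p).quasiMeasurePreserving.ae hp
  filter_upwards [h] with ω hω
  obtain ⟨v, hv⟩ := hω
  exact ⟨f v, infinite_cluster_map f hv⟩

theorem criticalProb_congr (f : H ≃g G) : G.criticalProb = H.criticalProb :=
  le_antisymm (criticalProb_le_of_embedding f.toEmbedding)
    (criticalProb_le_of_embedding f.symm.toEmbedding)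

/-- If all clusters of percolation on `G` are almost surely finite, then so are, in percolation
on `H`, all clusters within an embedded copy of `G`. -/
theorem ae_forall_finite_cluster_of_embedding (f : G ↪g H) {p : unitInterval}
    (h : ∀ᵐ ω ∂(G.percolation p), ∀ v, (G.cluster ω v).Finite) :
    ∀ᵐ ω ∂(H.percolation p), ∀ v, (G.cluster (Sym2.map f ⁻¹' ω) v).Finite :=
  (measurePreserving_percolation f p).quasiMeasurePreserving.ae h

theorem ae_forall_finite_cluster_congr (f : H ≃g G) {p : unitInterval}
    (h : ∀ᵐ ω ∂(G.percolation p), ∀ v, (G.cluster ω v).Finite) :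
    ∀ᵐ ω ∂(H.percolation p), ∀ v, (H.cluster ω v).Finite := by
  filter_upwards [ae_forall_finite_cluster_of_embedding f.symm.toEmbedding h] with ω hω v
  by_contra hv
  refine infinite_cluster_map f.toEmbedding (ω := Sym2.map f.symm ⁻¹' ω) (v := v) ?_ (hω (f v))
  have hid : Sym2.map f.toEmbedding ⁻¹' (Sym2.map f.symm ⁻¹' ω) = ω := by
    ext e
    induction e with
    | _ x y => simp
  rw [hid]
  exact hv

/-- Opening the single edge between two neighbours costs at most a factor `p`, so that if one of
them has an infinite cluster with positive probability, then so has the other. -/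
theorem infinite_cluster_pos_of_adj [Countable V] {p : unitInterval} (hp : 0 < p) {v w : V}
    (hvw : G.Adj v w) (h : 0 < (G.percolation p).real {ω | (G.cluster ω v).Infinite}) :
    0 < (G.percolation p).real {ω | (G.cluster ω w).Infinite} := by
  let A : Set (Set (Sym2 V)) := {ω | (G.cluster (insert s(v, w) ω) v).Infinite}
  let B : Set (Set (Sym2 V)) := {ω | s(v, w) ∈ ω}
  have hins : Measurable fun ω : Set (Sym2 V) => insert s(v, w) ω := by
    refine measurable_set_iff.2 fun e => ?_
    simp only [Set.mem_insert_iff]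
    exact measurable_const.or (measurable_mem_set e)
  have hA : MeasurableSet A := hins (G.measurableSet_infinite_cluster v)
  have hB : MeasurableSet B := (measurable_mem_set _).setOf
  have hind : (G.percolation p).real (A ∩ B) =
      (G.percolation p).real A * (G.percolation p).real B := by
    refine setBernoulli_real_inter (disjoint_compl_left (a := {s(v, w)})) hA hB (fun ω => ?_)
      fun ω => by simp [B]
    have : insert s(v, w) (ω ∩ {s(v, w)}ᶜ) = insert s(v, w) ω := by
      ext e
      by_cases he : e = s(v, w) <;> simp [he]
    simp only [A, Set.mem_ofPred_eq, this]
  have hmono : (G.percolation p).real {ω | (G.cluster ω v).Infinite} ≤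
      (G.percolation p).real A :=
    measureReal_mono fun ω hω => hω.mono fun x hx =>
      Reachable.mono (openGraph_mono fun e he => Or.inr he.2) hx
  have hBp : (G.percolation p).real B = p := setBernoulli_real_mem p hvw
  refine lt_of_lt_of_le (b := (G.percolation p).real (A ∩ B)) ?_ (measureReal_mono ?_)
  · rw [hind, hBp]
    exact mul_pos (lt_of_lt_of_le h hmono) hp
  · rintro ω ⟨hω, hB⟩
    have : insert s(v, w) ω = ω := Set.insert_eq_of_mem hB
    simp only [A, Set.mem_ofPred_eq, this] at hω
    rw [cluster_eq_of_reachable (openGraph_adj.2 ⟨hvw, hB⟩ : (G.openGraph ω).Adj v w).reachable]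
      at hω
    exact hω

/-- On a connected graph, the vertex whose cluster is infinite with positive probability can be
chosen at will. -/
theorem infinite_cluster_pos_of_not_ae_finite [Countable V] (hG : G.Preconnected)
    {p : unitInterval} (hp : 0 < p)
    (h : ¬ ∀ᵐ ω ∂(G.percolation p), ∀ v, (G.cluster ω v).Finite) (w : V) :
    0 < (G.percolation p).real {ω | (G.cluster ω w).Infinite} := by
  rw [ae_all_iff] at h
  push Not at h
  obtain ⟨v, hv⟩ := h
  have hpos : 0 < (G.percolation p).real {ω | (G.cluster ω v).Infinite} :=
    ENNReal.toReal_pos (fun h0 => hv (by simpa only [ae_iff, not_not] using h0))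
      (measure_ne_top _ _)
  obtain ⟨q⟩ := hG v w
  clear hv
  induction q with
  | nil => exact hpos
  | cons h _ ih => exact ih (infinite_cluster_pos_of_adj hp h hpos)

theorem ae_forall_finite_cluster_zero [Countable V] (G : SimpleGraph V) :
    ∀ᵐ ω ∂(G.percolation 0), ∀ v, (G.cluster ω v).Finite := by
  rw [percolation, setBernoulli_zero, ae_dirac_eq, eventually_pure]
  intro v
  refine (Set.finite_singleton v).subset ?_
  rintro w ⟨q⟩
  cases q with
  | nil => rfl
  | cons h _ => exact absurd (openGraph_adj.1 h).2 (Set.notMem_empty _)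

theorem not_ae_exists_infinite_cluster_zero [Countable V] (G : SimpleGraph V) :
    ¬ ∀ᵐ ω ∂(G.percolation 0), ∃ v, (G.cluster ω v).Infinite := by
  intro h
  obtain ⟨ω, ⟨v, hv⟩, hω⟩ := (h.and G.ae_forall_finite_cluster_zero).exists
  exact hv (hω v)

end SimpleGraph

theorem IsOpen.sInf_notMem {s : Set unitInterval} (hs : IsOpen s) (h0 : (0 : unitInterval) ∉ s) :
    sInf s ∉ s := by
  intro hmem
  have hpos : 0 < sInf s := lt_of_le_of_ne bot_le fun h => h0 (h ▸ hmem)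
  obtain ⟨l, hl, hls⟩ := exists_Ioc_subset_of_mem_nhds (hs.mem_nhds hmem) ⟨0, hpos⟩
  obtain ⟨b, hlb, hb⟩ := exists_between hl
  exact absurd (sInf_le (hls ⟨hlb, hb.le⟩)) (not_le.2 hb)

/-! ### Lamp graphs -/

section LampGraph

variable {Λ : Type*} [Zero Λ]

/-- A common model for the positive parts of Diestel–Leader graphs and of the lamplighter group.
The vertices are pairs `(j, f)` of a position `j : ℕ` and a configuration `f` of lamps with states
in `Λ`. An edge at site `s` joins vertices at the positions `s` and `s + 1` (or two vertices at the
same one of these positions) whose lamps agree away from `s`; which of the possible edges are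
present is prescribed by the graph `R` on the pairs (position relative to `s`, state of the lamp
at `s`). -/
def lampGraph (R : SimpleGraph (Fin 2 × Λ)) : SimpleGraph (ℕ × (ℕ →₀ Λ)) where
  Adj x y := ∃ (s : ℕ) (a b : Fin 2), x.1 = s + a ∧ y.1 = s + b ∧
    R.Adj (a, x.2 s) (b, y.2 s) ∧ ∀ i ≠ s, x.2 i = y.2 i
  symm := ⟨fun _ _ ⟨s, a, b, hx, hy, hR, h⟩ =>
    ⟨s, b, a, hy, hx, hR.symm, fun i hi => (h i hi).symm⟩⟩
  loopless := ⟨fun _ ⟨s, a, b, hx, hy, hR, _⟩ => by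
    have : a = b := Fin.ext (by omega)
    rw [this] at hR
    exact hR.ne rfl⟩

/-- The lamp configuration that is `h` on the first `n` sites and a translate of `f` beyond. -/
noncomputable def glueLamps (n : ℕ) (h : Fin n → Λ) (f : ℕ →₀ Λ) : ℕ →₀ Λ :=
  Finsupp.ofSupportFinite (fun i => if hi : i < n then h ⟨i, hi⟩ else f (i - n)) <| by
    refine ((Set.finite_Iio n).union (f.hasFiniteSupport.image (· + n))).subset fun i hi => ?_
    rw [Function.mem_support] at hi
    by_cases hin : i < n
    · exact Or.inl hin
    · rw [dif_neg hin] at hi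
      exact Or.inr ⟨i - n, hi, Nat.sub_add_cancel (not_lt.1 hin)⟩

theorem glueLamps_of_lt {n i : ℕ} (h : Fin n → Λ) (f : ℕ →₀ Λ) (hi : i < n) :
    glueLamps n h f i = h ⟨i, hi⟩ := dif_pos hi

theorem glueLamps_add (n i : ℕ) (h : Fin n → Λ) (f : ℕ →₀ Λ) :
    glueLamps n h f (n + i) = f i := by
  have h1 : glueLamps n h f (n + i) =
    if hi : n + i < n then h ⟨n + i, hi⟩ else f (n + i - n) := rfl
  rw [h1, dif_neg (by omega), Nat.add_sub_cancel_left]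

theorem glueLamps_of_le {n i : ℕ} (h : Fin n → Λ) (f : ℕ →₀ Λ) (hi : n ≤ i) :
    glueLamps n h f i = f (i - n) := by
  obtain ⟨k, rfl⟩ := Nat.exists_eq_add_of_le hi
  rw [glueLamps_add, Nat.add_sub_cancel_left]

theorem glueLamps_left_injective {n : ℕ} {h h' : Fin n → Λ} {f f' : ℕ →₀ Λ}
    (e : glueLamps n h f = glueLamps n h' f') : h = h' := by
  funext i
  have := DFunLike.congr_fun e i.1
  rwa [glueLamps_of_lt _ _ i.2, glueLamps_of_lt _ _ i.2] at this

theorem glueLamps_right_injective {n : ℕ} {h h' : Fin n → Λ} {f f' : ℕ →₀ Λ}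
    (e : glueLamps n h f = glueLamps n h' f') : f = f' := by
  ext i
  have := DFunLike.congr_fun e (n + i)
  rwa [glueLamps_add, glueLamps_add] at this

variable {R : SimpleGraph (Fin 2 × Λ)}

namespace lampGraph

theorem adj_glueLamps_iff {n : ℕ} {h : Fin n → Λ} {j j' : ℕ} {f f' : ℕ →₀ Λ} :
    (lampGraph R).Adj (n + j, glueLamps n h f) (n + j', glueLamps n h f') ↔
      (lampGraph R).Adj (j, f) (j', f') := by
  constructor
  · rintro ⟨s, a, b, hx, hy, hR, hoff⟩
    simp only at hx hy hR hoff
    rcases lt_or_ge s n with hs | hs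
    · -- the only such site is `n - 1`, whose lamp is frozen
      have : a = b := Fin.ext (by omega)
      rw [glueLamps_of_lt _ _ hs, glueLamps_of_lt _ _ hs, this] at hR
      exact absurd rfl hR.ne
    · obtain ⟨t, rfl⟩ := Nat.exists_eq_add_of_le hs
      rw [glueLamps_add, glueLamps_add] at hR
      refine ⟨t, a, b, by simp only; omega, by simp only; omega, hR, fun i hi => ?_⟩
      have := hoff (n + i) (by omega)
      rwa [glueLamps_add, glueLamps_add] at this
  · rintro ⟨s, a, b, hx, hy, hR, hoff⟩
    simp only at hx hy hR hoff
    refine ⟨n + s, a, b, by simp only; omega, by simp only; omega, ?_, fun i hi => ?_⟩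
    · simpa only [glueLamps_add] using hR
    · simp only
      rcases lt_or_ge i n with hin | hin
      · rw [glueLamps_of_lt _ _ hin, glueLamps_of_lt _ _ hin]
      · rw [glueLamps_of_le _ _ hin, glueLamps_of_le _ _ hin, hoff (i - n) (by omega)]

/-- The copy of the lamp graph that starts at position `n` and in which the first `n` lamps are
frozen in the state `h`. -/
noncomputable def shift (R : SimpleGraph (Fin 2 × Λ)) (n : ℕ) (h : Fin n → Λ) :
    lampGraph R ↪g lampGraph R where
  toFun x := (n + x.1, glueLamps n h x.2)
  inj' := fun x y hxy => by
    simp only [Prod.mk.injEq] at hxy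
    exact Prod.ext (by omega) (glueLamps_right_injective hxy.2)
  map_rel_iff' := adj_glueLamps_iff

theorem shift_apply (n : ℕ) (h : Fin n → Λ) (x : ℕ × (ℕ →₀ Λ)) :
    shift R n h x = (n + x.1, glueLamps n h x.2) := rfl

/-- The moves at a single site, with the other lamps as in `f`. -/
noncomputable def siteHom (R : SimpleGraph (Fin 2 × Λ)) (s : ℕ) (f : ℕ →₀ Λ) :
    R →g lampGraph R where
  toFun x := (s + x.1, f.update s x.2)
  map_rel' := by
    classical
    rintro ⟨a, c⟩ ⟨b, d⟩ h
    refine ⟨s, a, b, rfl, rfl, ?_, fun i hi => ?_⟩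
    · simpa [Finsupp.update_apply] using h
    · simp [Finsupp.update_apply, hi]

theorem reachable_site (hR : R.Preconnected) (s : ℕ) (f : ℕ →₀ Λ) (a b : Fin 2) (c : Λ) :
    (lampGraph R).Reachable (s + a, f) (s + b, f.update s c) := by
  have h := (hR (a, f s) (b, c)).map (siteHom R s f)
  have h1 : siteHom R s f (a, f s) = (s + a, f) := by
    change (s + (a : ℕ), f.update s (f s)) = _
    rw [Finsupp.update_self]
  rw [h1] at h
  exact h

theorem preconnected (hR : R.Preconnected) : (lampGraph R).Preconnected := by
  classical
  -- walking down from position `n`, switch off all the lamps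
  have hdown : ∀ (n : ℕ) (f : ℕ →₀ Λ), (∀ i, n ≤ i → f i = 0) →
      (lampGraph R).Reachable (n, f) (0, 0) := by
    intro n
    induction n with
    | zero =>
      intro f hf
      have : f = 0 := by
        ext i
        simp [hf i (Nat.zero_le i)]
      rw [this]
    | succ n ih =>
      intro f hf
      refine (reachable_site hR n f 1 0 0).trans (ih _ fun i hi => ?_)
      rw [Finsupp.update_apply]
      split_ifs with hin
      · rfl
      · exact hf i (by omega)
  have hup : ∀ (k j : ℕ) (f : ℕ →₀ Λ), (lampGraph R).Reachable (j, f) (j + k, f) := by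
    intro k j f
    induction k with
    | zero => exact .refl _
    | succ k ih =>
      have h := reachable_site hR (j + k) f 0 1 (f (j + k))
      rw [Finsupp.update_self] at h
      exact ih.trans h
  have h0 : ∀ x : ℕ × (ℕ →₀ Λ), (lampGraph R).Reachable x (0, 0) := by
    rintro ⟨j, f⟩
    obtain ⟨k, hk⟩ : ∃ k, ∀ i, k ≤ i → f i = 0 := by
      refine ⟨f.support.sup id + 1, fun i hi => ?_⟩
      by_contra h
      have := Finset.le_sup (f := id) (Finsupp.mem_support_iff.2 h)
      simp only [id] at this
      omega
    exact (hup k j f).trans (hdown _ f fun i hi => hk i (by omega))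
  exact fun x y => (h0 x).trans (h0 y).symm

/-- The vertices at the positions up to `n` all of whose lit lamps are among the first `n`. -/
def box (Λ : Type*) [Zero Λ] (n : ℕ) : Set (ℕ × (ℕ →₀ Λ)) :=
  {x | x.1 ≤ n ∧ ∀ i, n ≤ i → x.2 i = 0}

theorem eq_glueLamps_of_forall_le {n : ℕ} {f : ℕ →₀ Λ} (h : ∀ i, n ≤ i → f i = 0) :
    f = glueLamps n (fun i => f i) 0 := by
  ext i
  rcases lt_or_ge i n with hi | hi
  · rw [glueLamps_of_lt _ _ hi]
  · rw [glueLamps_of_le _ _ hi, h i hi]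
    rfl

theorem finite_box [Finite Λ] (n : ℕ) : (box Λ n).Finite := by
  refine ((Set.finite_Iic n).prod (Set.finite_range fun h : Fin n → Λ =>
    glueLamps n h 0)).subset ?_
  rintro ⟨j, f⟩ ⟨hj, hf⟩
  exact ⟨hj, _, (eq_glueLamps_of_forall_le hf).symm⟩

/-- The exits of the box, that is its vertices at position `n`. They are the starting points
`shift R n h (0, 0)` of the copies of the lamp graph. -/
noncomputable def exit (n : ℕ) (h : Fin n → Λ) : ℕ × (ℕ →₀ Λ) := (n, glueLamps n h 0)

theorem zero_mem_box (n : ℕ) : ((0, 0) : ℕ × (ℕ →₀ Λ)) ∈ box Λ n := ⟨Nat.zero_le _, fun _ _ => rfl⟩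

/-- The part of the lamp graph inside the box. -/
def boxGraph (R : SimpleGraph (Fin 2 × Λ)) (n : ℕ) : SimpleGraph (ℕ × (ℕ →₀ Λ)) where
  Adj x y := (lampGraph R).Adj x y ∧ x ∈ box Λ n ∧ y ∈ box Λ n
  symm := ⟨fun _ _ h => ⟨h.1.symm, h.2.2, h.2.1⟩⟩
  loopless := ⟨fun _ h => h.1.ne rfl⟩

theorem boxGraph_le (n : ℕ) : boxGraph R n ≤ lampGraph R := fun _ _ h => h.1

theorem finite_edgeSet_boxGraph [Finite Λ] (n : ℕ) : (boxGraph R n).edgeSet.Finite := by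
  refine (((finite_box n).prod (finite_box n)).image fun q : (ℕ × (ℕ →₀ Λ)) × (ℕ × (ℕ →₀ Λ)) =>
    s(q.1, q.2)).subset ?_
  intro e he
  induction e with
  | _ x y => exact ⟨(x, y), he.2, rfl⟩

theorem disjoint_edgeSet_boxGraph (n : ℕ) (h : Fin n → Λ) :
    Disjoint (boxGraph R n).edgeSet (Set.range (Sym2.map (shift R n h))) := by
  rw [Set.disjoint_right]
  rintro _ ⟨e, rfl⟩ he
  induction e with
  | _ x y =>
    obtain ⟨hadj, hx, hy⟩ := he
    have hkey : ∀ z, shift R n h z ∈ box Λ n → z = (0, 0) := by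
      rintro ⟨j, f⟩ ⟨h1, h2⟩
      simp only [shift_apply] at h1 h2
      refine Prod.ext (by simp only; omega) ?_
      ext i
      have := h2 (n + i) (by omega)
      rwa [glueLamps_add] at this
    rw [hkey x hx, hkey y hy] at hadj
    exact hadj.ne rfl

theorem disjoint_range_map_shift {n : ℕ} {h h' : Fin n → Λ} (hne : h ≠ h') :
    Disjoint (Set.range (Sym2.map (shift R n h))) (Set.range (Sym2.map (shift R n h'))) := by
  rw [Set.disjoint_right]
  rintro _ ⟨e, rfl⟩ ⟨e', he⟩
  have hmem := (Sym2.out_fst_mem e')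
  have hm : shift R n h (Quot.out e').1 ∈ Sym2.map (shift R n h') e := by
    rw [← he, Sym2.mem_map]
    exact ⟨_, hmem, rfl⟩
  obtain ⟨y, -, hy⟩ := Sym2.mem_map.1 hm
  exact hne (glueLamps_left_injective (congrArg Prod.snd hy)).symm

/-- The edges by which one can leave the box through the exit `exit n h`. (Edges that are not
present in the lamp graph do no harm here.) -/
noncomputable def outEdge (n : ℕ) (h : Fin n → Λ) (q : Fin 2 × Λ) : Sym2 (ℕ × (ℕ →₀ Λ)) :=
  s(exit n h, (n + q.1, (glueLamps n h 0).update n q.2))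

theorem outEdge_notMem_edgeSet (n : ℕ) (h : Fin n → Λ) (q : Fin 2 × Λ) :
    outEdge n h q ∉ (boxGraph R n).edgeSet := by
  classical
  rintro ⟨hadj, -, hbox⟩
  refine hadj.ne (Prod.ext ?_ ?_)
  · have := hbox.1
    simp only [exit] at this ⊢
    omega
  · have := hbox.2 n le_rfl
    ext i
    simp only [Finsupp.update_apply, exit] at this ⊢
    split_ifs with hi
    · rw [hi, glueLamps_of_le _ _ le_rfl]
      simpa using this.symm
    · rfl

/-- A step of the lamp graph that leaves the box starts at an exit and uses an exit edge. -/
theorem exists_outEdge_of_adj {n : ℕ} {x y : ℕ × (ℕ →₀ Λ)} (hxy : (lampGraph R).Adj x y)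
    (hx : x ∈ box Λ n) (hy : y ∉ box Λ n) :
    ∃ h, x = exit n h ∧ ∃ q, outEdge n h q = s(x, y) := by
  classical
  obtain ⟨j, f⟩ := x
  obtain ⟨j', f'⟩ := y
  obtain ⟨s, a, b, h1, h2, -, hoff⟩ := hxy
  simp only at h1 h2 hoff
  obtain ⟨hj, hf⟩ := hx
  simp only at hj hf
  have hns : n ≤ s := by
    by_contra hs
    exact hy ⟨by simp only; omega, fun i hi => by rw [← hoff i (by omega)]; exact hf i hi⟩
  have hjn : j = n := by omega
  have hsn : s = n := by omega
  subst hjn hsn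
  have hfg := eq_glueLamps_of_forall_le hf
  refine ⟨fun i => f i, Prod.ext rfl hfg, (b, f' s), ?_⟩
  have hup : (glueLamps s (fun i : Fin s => f i) 0).update s (f' s) = f' := by
    rw [← hfg]
    ext i
    rw [Finsupp.update_apply]
    split_ifs with hi
    · rw [hi]
    · exact hoff i hi
  simp only [outEdge, exit]
  rw [hup, ← hfg, h2]

end lampGraph

/-! ### Percolation on lamp graphs -/

namespace lampGraph

/-- The event that the exit `exit n h` can be reached from the root by an open path in the box. -/
def reach (R : SimpleGraph (Fin 2 × Λ)) (n : ℕ) (h : Fin n → Λ) :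
    Set (Set (Sym2 (ℕ × (ℕ →₀ Λ)))) :=
  {ω | ((boxGraph R n).openGraph ω).Reachable (0, 0) (exit n h)}

/-- The event that the cluster of the root contains a vertex at a position of at least `k`. -/
def far (R : SimpleGraph (Fin 2 × Λ)) (k : ℕ) : Set (Set (Sym2 (ℕ × (ℕ →₀ Λ)))) :=
  {ω | ∃ w ∈ (lampGraph R).cluster ω (0, 0), k ≤ w.1}

/-- The event that the cluster of the root is infinite. -/
def rootInfinite (R : SimpleGraph (Fin 2 × Λ)) : Set (Set (Sym2 (ℕ × (ℕ →₀ Λ)))) :=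
  {ω | ((lampGraph R).cluster ω (0, 0)).Infinite}

/-- The expected number of exits of the box that can be reached from the root. -/
noncomputable def meanExits [Fintype Λ] (R : SimpleGraph (Fin 2 × Λ)) (n : ℕ)
    (p : unitInterval) : ℝ :=
  ∑ h, ((lampGraph R).percolation p).real (reach R n h)

theorem reach_inter (n : ℕ) (h : Fin n → Λ) (ω : Set (Sym2 (ℕ × (ℕ →₀ Λ)))) :
    ω ∩ (boxGraph R n).edgeSet ∈ reach R n h ↔ ω ∈ reach R n h := by
  simp only [reach, Set.mem_ofPred_eq, SimpleGraph.openGraph_inter_edgeSet]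

theorem mem_cluster_of_mem_reach {n : ℕ} {h : Fin n → Λ} {ω : Set (Sym2 (ℕ × (ℕ →₀ Λ)))}
    (hω : ω ∈ reach R n h) : exit n h ∈ (lampGraph R).cluster ω (0, 0) :=
  hω.mono (SimpleGraph.openGraph_le_openGraph (boxGraph_le n) ω)

/-- If all the edges out of the exits that have been reached are closed, then the cluster of the
root stays in the box. -/
theorem cluster_subset_box {n : ℕ} {ω : Set (Sym2 (ℕ × (ℕ →₀ Λ)))}
    (hω : ∀ h, ω ∈ reach R n h → ∀ q, outEdge n h q ∉ ω) :
    (lampGraph R).cluster ω (0, 0) ⊆ box Λ n := by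
  have key : ∀ x y, ((lampGraph R).openGraph ω).Walk x y →
      ((boxGraph R n).openGraph ω).Reachable (0, 0) x → x ∈ box Λ n → y ∈ box Λ n := by
    intro x y q
    induction q with
    | nil => exact fun _ h => h
    | @cons x z _ h _ ih =>
      intro hx hxb
      rw [SimpleGraph.openGraph_adj] at h
      have hz : z ∈ box Λ n := by
        by_contra hz
        obtain ⟨g, rfl, q, hq⟩ := exists_outEdge_of_adj h.1 hxb hz
        exact hω g hx q (hq ▸ h.2)
      have hadj : ((boxGraph R n).openGraph ω).Adj x z :=
        SimpleGraph.openGraph_adj.2 ⟨⟨h.1, hxb, hz⟩, h.2⟩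
      exact ih (hx.trans hadj.reachable) hz
  rintro y ⟨q⟩
  exact key _ _ q (.refl _) (zero_mem_box n)

/-- To get far, it suffices to reach an exit of the box and to get far from there. -/
theorem reach_inter_preimage_far_subset (n k : ℕ) (h : Fin n → Λ) :
    reach R n h ∩ (fun ω => Sym2.map (shift R n h) ⁻¹' ω) ⁻¹' far R k ⊆ far R (n + k) := by
  rintro ω ⟨hω, w, hw, hk⟩
  refine ⟨shift R n h w, ?_, ?_⟩
  · exact SimpleGraph.Reachable.trans (mem_cluster_of_mem_reach hω)
      (SimpleGraph.reachable_openGraph_map (shift R n h) hw)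
  · rw [shift_apply]
    exact Nat.add_le_add_left hk n

section Finite

variable [Fintype Λ]

theorem measurableSet_reach (n : ℕ) (h : Fin n → Λ) : MeasurableSet (reach R n h) :=
  SimpleGraph.measurableSet_reachable _ _ _

theorem measurableSet_far (k : ℕ) : MeasurableSet (far R k) := by
  have : far R k = ⋃ w : ℕ × (ℕ →₀ Λ),
      {ω | ((lampGraph R).openGraph ω).Reachable (0, 0) w ∧ k ≤ w.1} := by
    ext ω
    simp [far, SimpleGraph.mem_cluster]
  rw [this]
  refine .iUnion fun w => ?_
  by_cases hk : k ≤ w.1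
  · simpa only [hk, and_true] using SimpleGraph.measurableSet_reachable _ _ _
  · simp [hk]

theorem continuous_meanExits (n : ℕ) : Continuous (meanExits R n) :=
  continuous_finsetSum _ fun h _ =>
    continuous_setBernoulli_real _ (finite_edgeSet_boxGraph n) (reach_inter n h)

/-- One generation of the branching process: if on average more than one exit is reached, then the
probability of getting far does not drop below the threshold `δ`. -/
theorem le_far_add {p : unitInterval} {n k : ℕ} {δ : ℝ} (hδ0 : 0 < δ)
    (hδ : Fintype.card (Fin n → Λ) ^ 2 * δ ≤ meanExits R n p - 1)
    (hk : δ ≤ ((lampGraph R).percolation p).real (far R k)) :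
    δ ≤ ((lampGraph R).percolation p).real (far R (n + k)) := by
  set μ := (lampGraph R).percolation p
  set π := μ.real (far R k) with hπ
  have hπ0 : 0 < π := hδ0.trans_le hk
  let D : (Fin n → Λ) → Set (Set (Sym2 (ℕ × (ℕ →₀ Λ)))) := fun h =>
    (fun ω => Sym2.map (shift R n h) ⁻¹' ω) ⁻¹' far R k
  have hDm : ∀ h, MeasurableSet (D h) := fun h => measurable_preimage_set _ (measurableSet_far k)
  have hDμ : ∀ h, μ.real (D h) = π := fun h =>
    (SimpleGraph.measurePreserving_percolation (shift R n h) p).measureReal_preimage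
      (measurableSet_far k).nullMeasurableSet
  have hDS : ∀ h ω, ω ∩ Set.range (Sym2.map (shift R n h)) ∈ D h ↔ ω ∈ D h := by
    intro h ω
    simp only [D, Set.mem_preimage, Set.preimage_inter_range]
  have hRD : ∀ h, μ.real (reach R n h ∩ D h) = μ.real (reach R n h) * π := by
    intro h
    rw [← hDμ h]
    exact setBernoulli_real_inter (disjoint_edgeSet_boxGraph n h) (measurableSet_reach n h)
      (hDm h) (reach_inter n h) (hDS h)
  have hDD : ∀ h h', h ≠ h' →
      μ.real ((reach R n h ∩ D h) ∩ (reach R n h' ∩ D h')) ≤ π ^ 2 := by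
    intro h h' hne
    have : μ.real (D h ∩ D h') = π ^ 2 := by
      rw [sq, ← hDμ h, hDμ h, ← hDμ h']
      nth_rw 1 [hDμ h', ← hDμ h]
      exact setBernoulli_real_inter (disjoint_range_map_shift hne) (hDm h) (hDm h') (hDS h) (hDS h')
    rw [← this]
    exact measureReal_mono fun ω hω => ⟨hω.1.2, hω.2.2⟩
  -- with `t = δ / π`, the lower bound no longer depends on `π`
  have hmain := sum_sub_sum_le_measureReal_iUnion μ (A := fun h => reach R n h ∩ D h)
    (fun h => (measurableSet_reach n h).inter (hDm h)) (t := δ / π) (by positivity)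
    ((div_le_one hπ0).2 hk) hDD (sq_nonneg π)
  have hsub : μ.real (⋃ h, reach R n h ∩ D h) ≤ μ.real (far R (n + k)) :=
    measureReal_mono (Set.iUnion_subset fun h => reach_inter_preimage_far_subset n k h)
  simp_rw [hRD, ← Finset.sum_mul] at hmain
  have hcalc : δ / π * ((∑ h, μ.real (reach R n h)) * π) -
      (δ / π) ^ 2 * (Fintype.card (Fin n → Λ) ^ 2 * π ^ 2) =
      δ * (∑ h, μ.real (reach R n h)) - δ * (Fintype.card (Fin n → Λ) ^ 2 * δ) := by
    field_simp
  rw [hcalc] at hmain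
  have hm : meanExits R n p = ∑ h, μ.real (reach R n h) := rfl
  rw [← hm] at hmain
  nlinarith [mul_le_mul_of_nonneg_left hδ hδ0.le]

theorem rootInfinite_pos_of_one_lt_meanExits {p : unitInterval} {n : ℕ}
    (hn : 1 < meanExits R n p) :
    0 < ((lampGraph R).percolation p).real (rootInfinite R) := by
  set μ := (lampGraph R).percolation p
  have hn0 : n ≠ 0 := by
    rintro rfl
    have : meanExits R 0 p ≤ 1 := by
      rw [meanExits, Fintype.sum_unique]
      exact measureReal_le_one
    linarith
  obtain ⟨δ, hδ0, hδ1, hδ⟩ : ∃ δ : ℝ, 0 < δ ∧ δ ≤ 1 ∧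
      Fintype.card (Fin n → Λ) ^ 2 * δ ≤ meanExits R n p - 1 := by
    have hc : (0 : ℝ) < Fintype.card (Fin n → Λ) ^ 2 := by
      have : 0 < Fintype.card (Fin n → Λ) := Fintype.card_pos
      positivity
    refine ⟨min 1 ((meanExits R n p - 1) / Fintype.card (Fin n → Λ) ^ 2), ?_, min_le_left _ _, ?_⟩
    · exact lt_min one_pos (div_pos (by linarith) hc)
    · calc _ ≤ (Fintype.card (Fin n → Λ) ^ 2 : ℝ) *
            ((meanExits R n p - 1) / Fintype.card (Fin n → Λ) ^ 2) :=
          mul_le_mul_of_nonneg_left (min_le_right _ _) hc.le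
        _ = _ := mul_div_cancel₀ _ hc.ne'
  have hfar : ∀ k, δ ≤ μ.real (far R (n * k)) := by
    intro k
    induction k with
    | zero =>
      have : far R (n * 0) = Set.univ :=
        Set.eq_univ_of_forall fun ω => ⟨(0, 0), SimpleGraph.Reachable.refl _, Nat.zero_le _⟩
      rw [this, probReal_univ]
      exact hδ1
    | succ k ih =>
      rw [Nat.mul_succ, Nat.add_comm]
      exact le_far_add hδ0 hδ ih
  have hanti : Antitone fun k => far R (n * k) := by
    rintro k l hkl ω ⟨w, hw, hl⟩
    exact ⟨w, hw, (Nat.mul_le_mul_left n hkl).trans hl⟩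
  have hlim := tendsto_measure_iInter_atTop (μ := μ)
    (fun k => (measurableSet_far (R := R) (n * k)).nullMeasurableSet) hanti
    ⟨0, measure_ne_top _ _⟩
  have hlim' := (ENNReal.tendsto_toReal (measure_ne_top _ _)).comp hlim
  have hle : δ ≤ μ.real (⋂ k, far R (n * k)) := ge_of_tendsto' hlim' hfar
  refine hδ0.trans_le (hle.trans (measureReal_mono fun ω hω hfin => ?_))
  obtain ⟨M, hM⟩ := (hfin.image Prod.fst).bddAbove
  obtain ⟨w, hw, hk⟩ := Set.mem_iInter.1 hω (M + 1)
  have h1 := hM ⟨w, hw, rfl⟩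
  have h2 := Nat.le_mul_of_pos_left (M + 1) (Nat.pos_of_ne_zero hn0)
  omega

/-- At a parameter `p < 1` for which the cluster of the root can be infinite, the number of exits
reached is large with non-vanishing probability: whenever it is at most `K` and not `0`, the cluster
ends at this box with a probability bounded below, and this happens for one `n` only. -/
theorem exists_one_lt_meanExits_of_lt_one {p : unitInterval} (hp : p < 1)
    (hinf : 0 < ((lampGraph R).percolation p).real (rootInfinite R)) :
    ∃ n, 1 < meanExits R n p := by
  classical
  by_contra! hmean
  set μ := (lampGraph R).percolation p
  obtain ⟨K, hK⟩ := exists_nat_one_div_lt hinf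
  let Z : (n : ℕ) → Finset (Fin n → Λ) → Set (Set (Sym2 (ℕ × (ℕ →₀ Λ)))) := fun n S =>
    {ω | ∀ h, h ∈ S ↔ ω ∈ reach R n h}
  let C : (n : ℕ) → Finset (Fin n → Λ) → Set (Set (Sym2 (ℕ × (ℕ →₀ Λ)))) := fun n S =>
    {ω | ∀ k : S × (Fin 2 × Λ), outEdge n k.1.1 k.2 ∉ ω}
  let 𝒮 : (n : ℕ) → Finset (Finset (Fin n → Λ)) := fun n =>
    Finset.univ.filter fun S => S.Nonempty ∧ S.card ≤ K
  let F : ℕ → Set (Set (Sym2 (ℕ × (ℕ →₀ Λ)))) := fun n => ⋃ S ∈ 𝒮 n, Z n S ∩ C n S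
  have hZm : ∀ n S, MeasurableSet (Z n S) := by
    intro n S
    have : Z n S = ⋂ h, if h ∈ S then reach R n h else (reach R n h)ᶜ := by
      ext ω
      simp only [Z, Set.mem_ofPred_eq, Set.mem_iInter]
      refine forall_congr' fun h => ?_
      by_cases hS : h ∈ S <;> simp [hS]
    rw [this]
    refine .iInter fun h => ?_
    split_ifs
    · exact measurableSet_reach n h
    · exact (measurableSet_reach n h).compl
  have hCm : ∀ n S, MeasurableSet (C n S) := by
    intro n S
    simp only [C, Set.ofPred_forall]
    exact .iInter fun k => (measurable_mem_set _).setOf.compl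
  have hFm : ∀ n, MeasurableSet (F n) := fun n =>
    Finset.measurableSet_biUnion _ fun S _ => (hZm n S).inter (hCm n S)
  -- on `F n`, the cluster of the root reaches position `n`, but not further
  have hFdisj : Pairwise (Function.onFun Disjoint F) := by
    have hF : ∀ n ω, ω ∈ F n → (∃ h : Fin n → Λ, exit n h ∈ (lampGraph R).cluster ω (0, 0)) ∧
        (lampGraph R).cluster ω (0, 0) ⊆ box Λ n := by
      intro n ω hω
      simp only [F, Set.mem_iUnion] at hω
      obtain ⟨S, hS, hZ, hC⟩ := hω
      obtain ⟨h, hh⟩ := (Finset.mem_filter.1 hS).2.1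
      exact ⟨⟨h, mem_cluster_of_mem_reach ((hZ h).1 hh)⟩,
        cluster_subset_box fun g hg q => hC (⟨g, (hZ g).2 hg⟩, q)⟩
    have hle : ∀ n m ω, ω ∈ F n → ω ∈ F m → n ≤ m := by
      intro n m ω hn hm
      obtain ⟨⟨h, hh⟩, -⟩ := hF n ω hn
      exact ((hF m ω hm).2 hh).1
    intro n m hnm
    exact Set.disjoint_left.2 fun ω hn hm => hnm (le_antisymm (hle n m ω hn hm) (hle m n ω hm hn))
  have hF0 : Tendsto (fun n => μ.real (F n)) atTop (nhds 0) := by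
    have hsum : ∑' n, μ (F n) ≠ ⊤ := by
      rw [← measure_iUnion hFdisj hFm]
      exact measure_ne_top _ _
    have := (ENNReal.tendsto_toReal ENNReal.zero_ne_top).comp
      (ENNReal.tendsto_atTop_zero_of_tsum_ne_top hsum)
    exact this
  let q : ℝ := (1 - p) ^ (K * Fintype.card (Fin 2 × Λ))
  have hp1 : (0 : ℝ) < 1 - p := sub_pos.2 hp
  have hq : 0 < q := by positivity
  have hZdisj : ∀ n, Set.PairwiseDisjoint (𝒮 n : Set (Finset (Fin n → Λ))) (Z n) := by
    intro n S _ S' _ hne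
    refine Set.disjoint_left.2 fun ω hS hS' => hne (Finset.ext fun h => ?_)
    exact (hS h).trans (hS' h).symm
  have hFq : ∀ n, q * μ.real (⋃ S ∈ 𝒮 n, Z n S) ≤ μ.real (F n) := by
    intro n
    rw [measureReal_biUnion_finset (hZdisj n) fun S _ => hZm n S,
      measureReal_biUnion_finset ((hZdisj n).mono_on fun S _ => Set.inter_subset_left)
        fun S _ => (hZm n S).inter (hCm n S), Finset.mul_sum]
    refine Finset.sum_le_sum fun S hS => ?_
    have hdisj : Disjoint (boxGraph R n).edgeSet
        (Set.range fun k : S × (Fin 2 × Λ) => outEdge n k.1.1 k.2) := by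
      rw [Set.disjoint_right]
      rintro _ ⟨k, rfl⟩
      exact outEdge_notMem_edgeSet n _ _
    have hind : μ.real (Z n S ∩ C n S) = μ.real (Z n S) * μ.real (C n S) :=
      setBernoulli_real_inter hdisj (hZm n S) (hCm n S)
        (fun ω => forall_congr' fun h => by rw [reach_inter]) fun ω => by
          refine forall_congr' fun k => not_congr ?_
          simp only [Set.mem_inter_iff, Set.mem_range, exists_apply_eq_apply, and_true]
    rw [hind, mul_comm]
    refine mul_le_mul_of_nonneg_left ?_ measureReal_nonneg
    refine le_trans ?_ (pow_card_le_setBernoulli_real_forall_notMem _ p _)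
    refine pow_le_pow_of_le_one hp1.le (by linarith [p.2.1]) ?_
    rw [Nat.card_prod, Nat.card_eq_fintype_card, Nat.card_eq_fintype_card, Fintype.card_coe]
    exact Nat.mul_le_mul_right _ (Finset.mem_filter.1 hS).2.2
  -- Markov's inequality for the number of exits reached
  have hmarkov : ∀ n, μ.real {ω | K + 1 ≤ (Finset.univ.filter fun h => ω ∈ reach R n h).card} ≤
      1 / (K + 1) := by
    intro n
    let I : (Fin n → Λ) → Set (Sym2 (ℕ × (ℕ →₀ Λ))) → ℝ := fun h => (reach R n h).indicator 1
    have hcard : ∀ ω, ((Finset.univ.filter fun h => ω ∈ reach R n h).card : ℝ) =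
        ∑ h, I h ω := by
      intro ω
      rw [Finset.card_filter]
      push_cast
      exact Finset.sum_congr rfl fun h _ => by simp [I, Set.indicator_apply]
    have hint : ∀ h, Integrable (I h) μ := fun h =>
      (integrable_const (1 : ℝ)).indicator (measurableSet_reach n h)
    have hexp : ∫ ω, ∑ h, I h ω ∂μ = meanExits R n p := by
      rw [integral_finsetSum _ fun h _ => hint h]
      exact Finset.sum_congr rfl fun h _ => integral_indicator_one (measurableSet_reach n h)
    have h := mul_meas_ge_le_integral_of_nonneg (μ := μ) (f := fun ω =>
      ∑ h, I h ω)
      (ae_of_all _ fun ω => Finset.sum_nonneg fun h _ =>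
        Set.indicator_nonneg (fun _ _ => zero_le_one) _)
      (integrable_finsetSum _ fun h _ => hint h) (K + 1)
    rw [hexp] at h
    have hset : {ω | K + 1 ≤ (Finset.univ.filter fun h => ω ∈ reach R n h).card} =
        {ω | (K + 1 : ℝ) ≤ ∑ h, I h ω} := by
      ext ω
      rw [Set.mem_ofPred_eq, Set.mem_ofPred_eq, ← hcard]
      norm_cast
    rw [hset, le_div_iff₀ (by positivity), mul_comm]
    exact h.trans (hmean n)
  have hcover : ∀ n, μ.real (rootInfinite R) ≤ μ.real (F n) / q + 1 / (K + 1) := by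
    intro n
    have hsub : rootInfinite R ⊆ (⋃ S ∈ 𝒮 n, Z n S) ∪
        {ω | K + 1 ≤ (Finset.univ.filter fun h => ω ∈ reach R n h).card} := by
      intro ω hω
      rw [Set.mem_union, or_iff_not_imp_right]
      intro hcard
      refine Set.mem_biUnion (x := Finset.univ.filter fun h => ω ∈ reach R n h) ?_ fun h => by simp
      refine Finset.mem_coe.2 (Finset.mem_filter.2 ⟨Finset.mem_univ _, ?_, ?_⟩)
      · by_contra hempty
        refine hω ((finite_box n).subset (cluster_subset_box fun h hh => ?_))
        exact absurd ⟨h, by simpa using hh⟩ hempty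
      · simp only [Set.mem_ofPred_eq] at hcard
        omega
    calc _ ≤ _ := measureReal_mono hsub
      _ ≤ _ := measureReal_union_le _ _
      _ ≤ _ := add_le_add ((le_div_iff₀' hq).2 (hFq n)) (hmarkov n)
  have hlim : Tendsto (fun n => μ.real (F n) / q + 1 / (K + 1 : ℝ)) atTop
      (nhds (0 / q + 1 / (K + 1 : ℝ))) := (hF0.div_const q).add_const _
  rw [zero_div, zero_add] at hlim
  exact absurd (ge_of_tendsto' hlim hcover) (not_le.2 hK)

theorem one_lt_meanExits_one [Nontrivial Λ] (hR : R.Preconnected) : 1 < meanExits R 1 1 := by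
  classical
  have h1 : ∀ h, ((lampGraph R).percolation 1).real (reach R 1 h) = 1 := by
    intro h
    have hmem : (lampGraph R).edgeSet ∈ reach R 1 h := by
      let φ : R →g (boxGraph R 1).openGraph (lampGraph R).edgeSet :=
        { toFun := fun x => siteHom R 0 0 x
          map_rel' := by
            intro x y hxy
            have hadj := (siteHom R 0 0).map_adj hxy
            have hbox : ∀ x, siteHom R 0 0 x ∈ box Λ 1 := by
              rintro ⟨a, c⟩
              refine ⟨?_, fun i hi => ?_⟩
              · change 0 + (a : ℕ) ≤ 1
                omega
              · change (0 : ℕ →₀ Λ).update 0 c i = 0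
                rw [Finsupp.update_apply, if_neg (by omega)]
                rfl
            exact SimpleGraph.openGraph_adj.2 ⟨⟨hadj, hbox x, hbox y⟩, hadj⟩ }
      have h2 := (hR (0, 0) (1, h 0)).map φ
      have e1 : φ (0, 0) = (0, 0) := by
        change (0 + 0, (0 : ℕ →₀ Λ).update 0 0) = _
        refine Prod.ext rfl ?_
        ext i
        simp
      have e2 : φ (1, h 0) = exit 1 h := by
        change (0 + 1, (0 : ℕ →₀ Λ).update 0 (h 0)) = _
        refine Prod.ext rfl ?_
        ext i
        simp only [Finsupp.update_apply, exit]
        split_ifs with hi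
        · subst hi
          exact (glueLamps_of_lt _ _ one_pos).symm
        · rw [glueLamps_of_le _ _ (by omega)]
          rfl
      rw [e1, e2] at h2
      exact h2
    rw [SimpleGraph.percolation, setBernoulli_one, measureReal_def,
      Measure.dirac_apply' _ (measurableSet_reach 1 h), Set.indicator_of_mem hmem]
    simp
  have hcard : 1 < Fintype.card Λ := Fintype.one_lt_card
  rw [meanExits, Finset.sum_congr rfl fun h _ => h1 h]
  simpa using hcard

/-- The cluster of the root can be infinite if and only if, for some box, more than one exit is
reached on average. The second condition is open in `p`. -/
theorem rootInfinite_pos_iff [Nontrivial Λ] (hR : R.Preconnected) {p : unitInterval} :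
    0 < ((lampGraph R).percolation p).real (rootInfinite R) ↔ ∃ n, 1 < meanExits R n p := by
  refine ⟨fun h => ?_, fun ⟨n, hn⟩ => rootInfinite_pos_of_one_lt_meanExits hn⟩
  rcases lt_or_eq_of_le (show p ≤ 1 from le_top) with hp | rfl
  · exact exists_one_lt_meanExits_of_lt_one hp h
  · exact ⟨1, one_lt_meanExits_one hR⟩

/-- A zero–one law: the probability `q` of having no infinite cluster satisfies `q ≤ q ^ 2`, because
the lamp graph contains two disjoint copies of itself. -/
theorem ae_exists_infinite_cluster [Nontrivial Λ] {p : unitInterval}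
    (h : 0 < ((lampGraph R).percolation p).real (rootInfinite R)) :
    ∀ᵐ ω ∂((lampGraph R).percolation p), ∃ v, ((lampGraph R).cluster ω v).Infinite := by
  set μ := (lampGraph R).percolation p
  let A : Set (Set (Sym2 (ℕ × (ℕ →₀ Λ)))) := {ω | ∃ v, ((lampGraph R).cluster ω v).Infinite}
  have hA : MeasurableSet A := SimpleGraph.measurableSet_exists_infinite_cluster _
  obtain ⟨c, c', hc⟩ := exists_pair_ne Λ
  let N : (Fin 1 → Λ) → Set (Set (Sym2 (ℕ × (ℕ →₀ Λ)))) := fun h =>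
    (fun ω => Sym2.map (shift R 1 h) ⁻¹' ω) ⁻¹' Aᶜ
  have hN : ∀ h, μ.real (N h) = μ.real Aᶜ := fun h =>
    (SimpleGraph.measurePreserving_percolation (shift R 1 h) p).measureReal_preimage
      hA.compl.nullMeasurableSet
  have hNm : ∀ h, MeasurableSet (N h) := fun h => measurable_preimage_set _ hA.compl
  have hNS : ∀ h ω, ω ∩ Set.range (Sym2.map (shift R 1 h)) ∈ N h ↔ ω ∈ N h := by
    intro h ω
    simp only [N, Set.mem_preimage, Set.preimage_inter_range]
  have hne : (fun _ : Fin 1 => c) ≠ fun _ => c' := fun h => hc (congrFun h 0)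
  have hind : μ.real (N (fun _ => c) ∩ N (fun _ => c')) =
      μ.real (N fun _ => c) * μ.real (N fun _ => c') :=
    setBernoulli_real_inter (disjoint_range_map_shift hne) (hNm _) (hNm _) (hNS _) (hNS _)
  rw [hN, hN] at hind
  have hle : μ.real Aᶜ ≤ μ.real Aᶜ * μ.real Aᶜ := by
    rw [← hind]
    have hsub : ∀ h, Aᶜ ⊆ N h := fun h ω hω ⟨v, hv⟩ =>
      hω ⟨_, SimpleGraph.infinite_cluster_map (shift R 1 h) hv⟩
    exact measureReal_mono (Set.subset_inter (hsub _) (hsub _))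
  have hlt : μ.real Aᶜ < 1 := by
    rw [probReal_compl_eq_one_sub hA]
    have : μ.real (rootInfinite R) ≤ μ.real A := measureReal_mono fun ω hω => ⟨_, hω⟩
    linarith
  have h0 : μ.real Aᶜ = 0 := by
    nlinarith [measureReal_nonneg (μ := μ) (s := Aᶜ)]
  rw [measureReal_eq_zero_iff] at h0
  exact h0

theorem setOf_ae_exists_infinite_cluster_eq [Nontrivial Λ] (hR : R.Preconnected) :
    {p | ∀ᵐ ω ∂((lampGraph R).percolation p), ∃ v, ((lampGraph R).cluster ω v).Infinite} =
      {p | ∃ n, 1 < meanExits R n p} := by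
  ext p
  rw [Set.mem_ofPred_eq, Set.mem_ofPred_eq, ← rootInfinite_pos_iff hR]
  refine ⟨fun h => ?_, ae_exists_infinite_cluster⟩
  refine SimpleGraph.infinite_cluster_pos_of_not_ae_finite (preconnected hR) ?_ ?_ _
  · refine lt_of_le_of_ne bot_le ?_
    rintro rfl
    exact SimpleGraph.not_ae_exists_infinite_cluster_zero _ h
  · intro h'
    obtain ⟨ω, ⟨v, hv⟩, hω⟩ := (h.and h').exists
    exact hv (hω v)

/-- If it is not almost sure that an infinite cluster exists, then it is almost sure that none
exists. -/
theorem ae_forall_finite_cluster [Nontrivial Λ] (hR : R.Preconnected) {p : unitInterval}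
    (hp : ¬ ∀ᵐ ω ∂((lampGraph R).percolation p), ∃ v, ((lampGraph R).cluster ω v).Infinite) :
    ∀ᵐ ω ∂((lampGraph R).percolation p), ∀ v, ((lampGraph R).cluster ω v).Finite := by
  rcases eq_or_lt_of_le (show 0 ≤ p from bot_le) with rfl | hp0
  · exact SimpleGraph.ae_forall_finite_cluster_zero _
  · by_contra h
    exact hp (ae_exists_infinite_cluster
      (SimpleGraph.infinite_cluster_pos_of_not_ae_finite (preconnected hR) hp0 h _))

/-- There is no infinite cluster up to and including the critical probability, since the set of all
`p` for which there is one is open. -/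
theorem ae_forall_finite_cluster_of_le_criticalProb [Nontrivial Λ] (hR : R.Preconnected)
    {p : unitInterval} (hp : p ≤ (lampGraph R).criticalProb) :
    ∀ᵐ ω ∂((lampGraph R).percolation p), ∀ v, ((lampGraph R).cluster ω v).Finite := by
  refine ae_forall_finite_cluster hR fun h => ?_
  have hopen : IsOpen {p | ∀ᵐ ω ∂((lampGraph R).percolation p),
      ∃ v, ((lampGraph R).cluster ω v).Infinite} := by
    rw [setOf_ae_exists_infinite_cluster_eq hR, Set.ofPred_exists]
    exact isOpen_iUnion fun n => isOpen_lt continuous_const (continuous_meanExits n)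
  have hpc : p = (lampGraph R).criticalProb := le_antisymm hp (sInf_le h)
  rw [hpc] at h
  exact hopen.sInf_notMem (SimpleGraph.not_ae_exists_infinite_cluster_zero _) h

end Finite

end lampGraph

end LampGraph

/-! ### Embeddings into components and induced subgraphs -/

namespace SimpleGraph

variable {V W : Type*} {G : SimpleGraph V} {H : SimpleGraph W}

/-- An embedding of a connected graph, as an embedding into the component that it meets. -/
def Embedding.toComponent (f : H ↪g G) (hH : H.Preconnected) (C : G.ConnectedComponent) (w : W)
    (hw : f w ∈ C) : H ↪g C.toSimpleGraph where
  toFun x := ⟨f x, by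
    have h : G.Reachable (f x) (f w) := (hH x w).map f.toHom
    exact (ConnectedComponent.sound h).trans hw⟩
  inj' x y hxy := f.injective (congrArg Subtype.val hxy)
  map_rel_iff' := f.map_adj_iff

/-- An embedding, as an isomorphism onto the subgraph induced by its range. -/
noncomputable def Embedding.isoInduce (f : H ↪g G) (S : Set V) (hS : Set.range f = S) :
    H ≃g G.induce S where
  toEquiv := Equiv.ofBijective (fun w => (⟨f w, hS ▸ ⟨w, rfl⟩⟩ : S))
    ⟨fun _ _ h => f.injective (congrArg Subtype.val h), fun ⟨v, hv⟩ => by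
      rw [← hS] at hv
      obtain ⟨w, rfl⟩ := hv
      exact ⟨w, rfl⟩⟩
  map_rel_iff' := f.map_adj_iff

/-- An infinite open simple path that ends up in an embedded graph yields an infinite cluster. -/
theorem exists_infinite_cluster_of_path (f : H ↪g G) {ω : Set (Sym2 V)} {x : ℕ → V}
    (hinj : Function.Injective x) (hadj : ∀ n, (G.openGraph ω).Adj (x n) (x (n + 1))) {N : ℕ}
    (hx : ∀ n, N ≤ n → x n ∈ Set.range f) :
    ∃ v, (H.cluster (Sym2.map f ⁻¹' ω) v).Infinite := by
  choose y hy using fun n => hx (N + n) (Nat.le_add_right N n)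
  have hyinj : Function.Injective y := fun m n hmn => by
    have := hinj ((hy m).symm.trans ((congrArg f hmn).trans (hy n)))
    omega
  refine ⟨y 0, (Set.infinite_range_of_injective hyinj).mono ?_⟩
  rintro _ ⟨n, rfl⟩
  induction n with
  | zero => exact Reachable.refl _
  | succ n ih =>
    have h := hadj (N + n)
    rw [← hy n, Nat.add_assoc, ← hy (n + 1), openGraph_adj_map] at h
    exact Reachable.trans ih h.reachable

end SimpleGraph

/-! ### Diestel–Leader graphs as lamp graphs -/

/-- The rule of the Diestel–Leader graphs: each step changes the position, and then the lamp passed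
can be put into any state. -/
def dlRule (Λ : Type*) : SimpleGraph (Fin 2 × Λ) where
  Adj x y := x.1 ≠ y.1
  symm := ⟨fun _ _ h => h.symm⟩
  loopless := ⟨fun _ h => h rfl⟩

theorem preconnected_dlRule (Λ : Type*) : (dlRule Λ).Preconnected := by
  rintro ⟨a, c⟩ ⟨b, d⟩
  by_cases hab : a = b
  · have h1 : (dlRule Λ).Adj (a, c) (1 - a, d) := by
      change a ≠ 1 - a
      omega
    have h2 : (dlRule Λ).Adj (1 - a, d) (b, d) := by
      change 1 - a ≠ b
      omega
    exact h1.reachable.trans h2.reachable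
  · exact SimpleGraph.Adj.reachable (G := dlRule Λ) hab

theorem lampGraph_dlRule_adj {Λ : Type*} [Zero Λ] {x y : ℕ × (ℕ →₀ Λ)} :
    (lampGraph (dlRule Λ)).Adj x y ↔ (x.1 = y.1 + 1 ∧ ∀ i ≠ y.1, x.2 i = y.2 i) ∨
      (y.1 = x.1 + 1 ∧ ∀ i ≠ x.1, y.2 i = x.2 i) := by
  constructor
  · rintro ⟨s, a, b, hx, hy, hR, hoff⟩
    have hab : a ≠ b := hR
    rcases (show (a : ℕ) = 1 ∧ (b : ℕ) = 0 ∨ (a : ℕ) = 0 ∧ (b : ℕ) = 1 by omega) with h | h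
    · exact Or.inl ⟨by omega, fun i hi => hoff i (by omega)⟩
    · exact Or.inr ⟨by omega, fun i hi => (hoff i (by omega)).symm⟩
  · rintro (⟨h, hoff⟩ | ⟨h, hoff⟩)
    · exact ⟨y.1, 1, 0, h, rfl, one_ne_zero, hoff⟩
    · exact ⟨x.1, 0, 1, rfl, h, zero_ne_one, fun i hi => (hoff i hi).symm⟩

namespace TreeVertex

variable {α : ℕ} [NeZero α]

theorem isDescendant_iff {u v : TreeVertex α} :
    v.IsDescendant u ↔ ∃ n : ℕ, v.level - n = u.level ∧ ∀ k, v.2 (k + n) = u.2 k := by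
  refine exists_congr fun n => ⟨?_, fun ⟨h1, h2⟩ => Prod.ext ?_ ?_⟩
  · rintro rfl
    exact ⟨(level_iterate n v).symm, fun k => (labels_iterate n k v).symm⟩
  · exact (level_iterate n v).trans h1
  · ext k
    rw [labels_iterate, h2]

theorem parent_eq_iff {u v : TreeVertex α} :
    v.parent = u ↔ v.level - 1 = u.level ∧ ∀ k, v.2 (k + 1) = u.2 k :=
  ⟨by rintro rfl; exact ⟨rfl, fun _ => rfl⟩, fun h => Prod.ext h.1 (Finsupp.ext h.2)⟩

theorem IsDescendant.of_adj {u v w : TreeVertex α} (h : v.IsDescendant u)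
    (hvw : v.parent = w ∨ w.parent = v) (hl : u.level ≤ w.level) : w.IsDescendant u := by
  obtain ⟨n, hn⟩ := h
  rcases hvw with rfl | rfl
  · cases n with
    | zero =>
      have huv : v = u := hn
      rw [huv, level_parent] at hl
      omega
    | succ n => exact ⟨n, hn⟩
  · exact ⟨n + 1, hn⟩

end TreeVertex

section DiestelLeader

variable {α : ℕ} [NeZero α]

theorem dlProduct_adj {x y : TreeVertex α × TreeVertex α} :
    (dlProduct α α).Adj x y ↔ (x.1.parent = y.1 ∧ y.2.parent = x.2) ∨
      (y.1.parent = x.1 ∧ x.2.parent = y.2) := by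
  rw [dlProduct, SimpleGraph.fromRel_adj, eq_comm (a := x.2), eq_comm (a := y.2)]
  refine and_iff_right_of_imp ?_
  rintro h rfl
  have : x.1.parent = x.1 := h.elim And.left And.left
  have := congrArg TreeVertex.level this
  rw [TreeVertex.level_parent] at this
  omega

theorem level_add_level_of_reachable {x y : TreeVertex α × TreeVertex α}
    (h : (dlProduct α α).Reachable x y) :
    x.1.level + x.2.level = y.1.level + y.2.level := by
  obtain ⟨q⟩ := h
  induction q with
  | nil => rfl
  | cons h _ ih =>
    rw [← ih]
    rcases dlProduct_adj.1 h with ⟨h1, h2⟩ | ⟨h1, h2⟩ <;>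
    · rw [← h1, ← h2, TreeVertex.level_parent, TreeVertex.level_parent]
      ring

/-- A lamp configuration and a position `j` describe a pair of vertices of the two trees: the lamps
below `j`, read downwards from `j - 1`, are the labels of the upward path in the first tree until
that path reaches `u.1`, and the lamps from `j` on are the labels of the upward path in the second
tree. -/
noncomputable def dlOfLamps (u : TreeVertex α × TreeVertex α) (x : ℕ × (ℕ →₀ Fin α)) :
    TreeVertex α × TreeVertex α :=
  ((u.1.level + x.1, glueLamps x.1 (fun i => x.2 (x.1 - 1 - i)) u.1.2),
    (u.2.level - x.1, x.2.comapDomain (x.1 + ·) (add_right_injective x.1).injOn))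

theorem dlOfLamps_fst_snd (u : TreeVertex α × TreeVertex α) (x : ℕ × (ℕ →₀ Fin α)) :
    (dlOfLamps u x).1.2 = glueLamps x.1 (fun i => x.2 (x.1 - 1 - i)) u.1.2 := rfl

theorem dlOfLamps_parent_iff (u : TreeVertex α × TreeVertex α) (x y : ℕ × (ℕ →₀ Fin α)) :
    ((dlOfLamps u x).1.parent = (dlOfLamps u y).1 ∧
      (dlOfLamps u y).2.parent = (dlOfLamps u x).2) ↔
      x.1 = y.1 + 1 ∧ ∀ i ≠ y.1, x.2 i = y.2 i := by
  obtain ⟨j, f⟩ := x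
  obtain ⟨j', f'⟩ := y
  rw [TreeVertex.parent_eq_iff, TreeVertex.parent_eq_iff]
  simp only [dlOfLamps, TreeVertex.level, Finsupp.comapDomain_apply]
  constructor
  · rintro ⟨⟨h1, h2⟩, -, h4⟩
    have hj : j = j' + 1 := by omega
    subst hj
    refine ⟨rfl, fun i hi => ?_⟩
    rcases lt_or_gt_of_ne hi with hi | hi
    · have := h2 (j' - 1 - i)
      rw [glueLamps_of_lt _ _ (by omega), glueLamps_of_lt _ _ (by omega)] at this
      convert this using 2 <;> simp only <;> omega
    · have := h4 (i - (j' + 1))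
      convert this.symm using 2 <;> omega
  · rintro ⟨rfl, h⟩
    refine ⟨⟨by push_cast; ring, fun k => ?_⟩, by push_cast; ring, fun k => ?_⟩
    · rcases lt_or_ge k j' with hk | hk
      · rw [glueLamps_of_lt _ _ (by omega), glueLamps_of_lt _ _ hk, h _ (by simp only; omega)]
        congr 1
        simp only
        omega
      · rw [glueLamps_of_le _ _ (by omega), glueLamps_of_le _ _ hk]
        congr 1
        omega
    · rw [h _ (by omega)]
      congr 1
      omega

/-- The lamp graph, embedded into the product with its root `(0, u.2.2)` at the vertex `u`. -/
noncomputable def dlEmbedding (u : TreeVertex α × TreeVertex α) :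
    lampGraph (dlRule (Fin α)) ↪g dlProduct α α where
  toFun := dlOfLamps u
  inj' := by
    rintro ⟨j, f⟩ ⟨j', f'⟩ h
    simp only [dlOfLamps, Prod.mk.injEq] at h
    obtain ⟨⟨h1, h2⟩, -, h4⟩ := h
    have hj : j = j' := by omega
    subst hj
    refine Prod.ext rfl (Finsupp.ext fun i => ?_)
    rcases lt_or_ge i j with hi | hi
    · have := DFunLike.congr_fun h2 (j - 1 - i)
      rw [glueLamps_of_lt _ _ (by omega), glueLamps_of_lt _ _ (by omega)] at this
      have e : j - 1 - (j - 1 - i) = i := by omega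
      simpa only [e] using this
    · have := DFunLike.congr_fun h4 (i - j)
      simp only [Finsupp.comapDomain_apply] at this
      rwa [Nat.add_sub_cancel' hi] at this
  map_rel_iff' := by
    intro x y
    exact dlProduct_adj.trans ((or_congr (dlOfLamps_parent_iff u x y)
      (dlOfLamps_parent_iff u y x)).trans lampGraph_dlRule_adj.symm)

theorem dlEmbedding_root (u : TreeVertex α × TreeVertex α) : dlEmbedding u (0, u.2.2) = u := by
  change dlOfLamps u (0, u.2.2) = u
  refine Prod.ext (Prod.ext ?_ (Finsupp.ext fun i => ?_)) (Prod.ext ?_ (Finsupp.ext fun i => ?_))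
  · simp [dlOfLamps, TreeVertex.level]
  · rw [dlOfLamps_fst_snd, glueLamps_of_le _ _ (Nat.zero_le _)]
    rfl
  · simp [dlOfLamps, TreeVertex.level]
  · simp [dlOfLamps]

/-- The condition on the levels holds throughout the component of `u`. -/
theorem mem_range_dlEmbedding {u v : TreeVertex α × TreeVertex α} :
    v ∈ Set.range (dlEmbedding u) ↔ v.1.IsDescendant u.1 ∧
      v.1.level + v.2.level = u.1.level + u.2.level := by
  rw [TreeVertex.isDescendant_iff]
  constructor
  · rintro ⟨⟨j, f⟩, rfl⟩
    change (∃ n : ℕ, (dlOfLamps u (j, f)).1.level - n = u.1.level ∧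
      ∀ k, (dlOfLamps u (j, f)).1.2 (k + n) = u.1.2 k) ∧ _
    refine ⟨⟨j, ?_, fun k => ?_⟩, ?_⟩
    · simp [dlOfLamps, TreeVertex.level]
    · rw [dlOfLamps_fst_snd, Nat.add_comm, glueLamps_add]
    · change u.1.level + (j : ℤ) + (u.2.level - j) = _
      ring
  · rintro ⟨⟨j, h1, h2⟩, h3⟩
    refine ⟨(j, glueLamps j (fun i => v.1.2 (j - 1 - i)) v.2.2), ?_⟩
    change dlOfLamps u _ = v
    refine Prod.ext (Prod.ext ?_ (Finsupp.ext fun i => ?_)) (Prod.ext ?_ (Finsupp.ext fun i => ?_))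
    · simp only [dlOfLamps]
      change _ = v.1.level
      omega
    · simp only [dlOfLamps]
      rcases lt_or_ge i j with hi | hi
      · rw [glueLamps_of_lt _ _ hi, glueLamps_of_lt _ _ (by simp only; omega)]
        congr 1
        simp only
        omega
      · rw [glueLamps_of_le _ _ hi, ← h2, Nat.sub_add_cancel hi]
    · simp only [dlOfLamps]
      change _ = v.2.level
      omega
    · simp only [dlOfLamps, Finsupp.comapDomain_apply]
      exact glueLamps_add _ _ _ _

/-- The exchange of the two trees. -/
def dlSwap (α : ℕ) [NeZero α] : dlProduct α α ≃g dlProduct α α where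
  toEquiv := Equiv.prodComm _ _
  map_rel_iff' {x y} := by
    rw [dlProduct_adj, dlProduct_adj]
    change (x.2.parent = y.2 ∧ y.1.parent = x.1) ∨ (y.2.parent = x.2 ∧ x.1.parent = y.1) ↔ _
    tauto

variable {o : TreeVertex α × TreeVertex α}

/-- The positive part of the Diestel–Leader graph with respect to its vertex `u`. -/
noncomputable def dlPositive (u : DLVertex o) :
    lampGraph (dlRule (Fin α)) ↪g diestelLeader o :=
  (dlEmbedding u.1).toComponent (lampGraph.preconnected (preconnected_dlRule _)) _ (0, u.1.2.2)
    (by rw [dlEmbedding_root]; exact u.2)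

/-- The part of the Diestel–Leader graph below its vertex `u` in the second tree. -/
noncomputable def dlNegative (u : DLVertex o) :
    lampGraph (dlRule (Fin α)) ↪g diestelLeader o :=
  ((dlSwap α).toEmbedding.comp (dlEmbedding u.1.swap)).toComponent
    (lampGraph.preconnected (preconnected_dlRule _)) _ (0, u.1.swap.2.2)
    (by
      change (dlEmbedding u.1.swap (0, u.1.swap.2.2)).swap ∈ _
      rw [dlEmbedding_root, Prod.swap_swap]
      exact u.2)

theorem DLVertex.level_add_level (u v : DLVertex o) :
    v.1.1.level + v.1.2.level = u.1.1.level + u.1.2.level :=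
  level_add_level_of_reachable (SimpleGraph.ConnectedComponent.exact (v.2.trans u.2.symm))

theorem mem_range_dlPositive {u v : DLVertex o} :
    v ∈ Set.range (dlPositive u) ↔ v.1.1.IsDescendant u.1.1 := by
  have h := mem_range_dlEmbedding (u := u.1) (v := v.1)
  rw [and_iff_left (DLVertex.level_add_level u v)] at h
  rw [← h]
  exact exists_congr fun x => Subtype.ext_iff

theorem mem_range_dlNegative {u v : DLVertex o} :
    v ∈ Set.range (dlNegative u) ↔ v.1.2.IsDescendant u.1.2 := by
  have h := mem_range_dlEmbedding (u := u.1.swap) (v := v.1.swap)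
  have hl : v.1.swap.1.level + v.1.swap.2.level = u.1.swap.1.level + u.1.swap.2.level := by
    have := DLVertex.level_add_level u v
    simp only [Prod.fst_swap, Prod.snd_swap]
    omega
  rw [and_iff_left hl] at h
  change _ ↔ v.1.swap.1.IsDescendant u.1.swap.1
  rw [← h]
  refine exists_congr fun x => Subtype.ext_iff.trans ?_
  change (dlEmbedding u.1.swap x).swap = v.1 ↔ _
  exact Prod.swap_inj.symm.trans (by rw [Prod.swap_swap])

/-- The positive part with respect to `o` is the lamp graph with the Diestel–Leader rule. -/
noncomputable def lampGraphIsoDlPositivePart (o : TreeVertex α × TreeVertex α) :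
    lampGraph (dlRule (Fin α)) ≃g dlPositivePart o :=
  (dlPositive (o := o) ⟨o, rfl⟩).isoInduce (dlPositiveSet o)
    (Set.ext fun _ => mem_range_dlPositive)

theorem exists_forall_ge_of_eventually_ge {g : ℕ → ℤ} {c : ℤ} (h : ∀ᶠ n in atTop, c ≤ g n) :
    ∃ N, ∀ n, N ≤ n → g N ≤ g n := by
  obtain ⟨M, hM⟩ := eventually_atTop.1 h
  let s : Set ℕ := {k | ∃ n, M ≤ n ∧ (g n - c).toNat = k}
  have hs : s.Nonempty := ⟨_, M, le_rfl, rfl⟩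
  obtain ⟨N, hN, hk⟩ := Nat.sInf_mem hs
  refine ⟨N, fun n hn => ?_⟩
  have h1 : sInf s ≤ (g n - c).toNat := Nat.sInf_le ⟨n, by omega, rfl⟩
  have h2 := hM N hN
  have h3 := hM n (by omega)
  omega

/-- If no positive or negative part has an infinite cluster, then an infinite open simple path
visits the levels on both sides of any given one infinitely often: otherwise, from the time at
which it attains the extremal level that it still visits, it stays in one such part. -/
theorem frequently_level_of_forall_finite_cluster {ω : Set (Sym2 (DLVertex o))}
    (hpos : ∀ (u : DLVertex o) v, ((lampGraph (dlRule (Fin α))).cluster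
      (Sym2.map (dlPositive u) ⁻¹' ω) v).Finite)
    (hneg : ∀ (u : DLVertex o) v, ((lampGraph (dlRule (Fin α))).cluster
      (Sym2.map (dlNegative u) ⁻¹' ω) v).Finite)
    {x : ℕ → DLVertex o} (hinj : Function.Injective x)
    (hadj : ∀ n, ((diestelLeader o).openGraph ω).Adj (x n) (x (n + 1))) (c : ℤ) :
    (∃ᶠ n in atTop, (x n).level < c) ∧ (∃ᶠ n in atTop, c < (x n).level) := by
  have hstep : ∀ n, (dlProduct α α).Adj (x n).1 (x (n + 1)).1 := fun n =>
    (SimpleGraph.openGraph_adj.1 (hadj n)).1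
  constructor
  · intro hev
    simp only [not_lt] at hev
    obtain ⟨N, hN⟩ := exists_forall_ge_of_eventually_ge hev
    obtain ⟨v, hv⟩ := SimpleGraph.exists_infinite_cluster_of_path (dlPositive (x N)) hinj hadj
      (N := N) fun n hn => by
        rw [mem_range_dlPositive]
        induction n, hn using Nat.le_induction with
        | base => exact ⟨0, rfl⟩
        | succ n hn ih =>
          refine ih.of_adj ?_ (hN (n + 1) (by omega))
          exact (dlProduct_adj.1 (hstep n)).imp And.left And.left
    exact hv (hpos _ v)
  · intro hev
    simp only [not_lt] at hev
    have hev' : ∀ᶠ n in atTop, -c ≤ -(x n).level := hev.mono fun n hn => neg_le_neg hn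
    obtain ⟨N, hN⟩ := exists_forall_ge_of_eventually_ge hev'
    obtain ⟨v, hv⟩ := SimpleGraph.exists_infinite_cluster_of_path (dlNegative (x N)) hinj hadj
      (N := N) fun n hn => by
        rw [mem_range_dlNegative]
        induction n, hn using Nat.le_induction with
        | base => exact ⟨0, rfl⟩
        | succ n hn ih =>
          refine ih.of_adj ((dlProduct_adj.1 (hstep n)).symm.imp And.right And.right) ?_
          have h1 := hN (n + 1) (by omega)
          have h2 := DLVertex.level_add_level (x N) (x (n + 1))
          simp only [DLVertex.level] at h1
          omega
    exact hv (hneg _ v)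

end DiestelLeader

/-! ### The lamplighter group as a lamp graph -/

/-- The rule of the lamplighter group: switch the current lamp, or move without touching any
lamp. -/
def lamplighterRule : SimpleGraph (Fin 2 × Fin 2) where
  Adj x y := (x.1 = 0 ∧ y.1 = 0 ∧ x.2 ≠ y.2) ∨ (x.1 ≠ y.1 ∧ x.2 = y.2)
  symm := ⟨fun _ _ h => h.imp (fun h => ⟨h.2.1, h.1, h.2.2.symm⟩) fun h => ⟨h.1.symm, h.2.symm⟩⟩
  loopless := ⟨fun _ h => h.elim (fun h => h.2.2 rfl) fun h => h.1 rfl⟩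

theorem preconnected_lamplighterRule : lamplighterRule.Preconnected := by
  have hmove : ∀ (a b c : Fin 2), lamplighterRule.Reachable (a, c) (b, c) := by
    intro a b c
    by_cases hab : a = b
    · rw [hab]
    · exact SimpleGraph.Adj.reachable (G := lamplighterRule) (Or.inr ⟨hab, rfl⟩)
  rintro ⟨a, c⟩ ⟨b, d⟩
  refine (hmove a 0 c).trans (.trans ?_ (hmove 0 b d))
  by_cases hcd : c = d
  · rw [hcd]
  · exact SimpleGraph.Adj.reachable (G := lamplighterRule) (Or.inl ⟨rfl, rfl, hcd⟩)

theorem lampGraph_lamplighterRule_adj {x y : ℕ × (ℕ →₀ Fin 2)} :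
    (lampGraph lamplighterRule).Adj x y ↔
      (x.1 = y.1 ∧ x.2 x.1 ≠ y.2 x.1 ∧ ∀ i ≠ x.1, x.2 i = y.2 i) ∨
      (y.1 = x.1 + 1 ∧ x.2 = y.2) ∨ (x.1 = y.1 + 1 ∧ x.2 = y.2) := by
  constructor
  · rintro ⟨s, a, b, hx, hy, hR, hoff⟩
    obtain ⟨ha, hb, hne⟩ | ⟨hab, heq⟩ := hR
    · simp only at ha hb hne
      subst ha hb
      have hs : x.1 = s := hx
      rw [hs]
      exact Or.inl ⟨hy.symm, hne, hoff⟩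
    · simp only at hab heq
      have hxy : x.2 = y.2 := by
        ext i
        by_cases hi : i = s
        · rw [hi, heq]
        · rw [hoff i hi]
      exact Or.inr ((show y.1 = x.1 + 1 ∨ x.1 = y.1 + 1 by omega).imp (⟨·, hxy⟩) (⟨·, hxy⟩))
  · rintro (⟨h, hne, hoff⟩ | ⟨h, heq⟩ | ⟨h, heq⟩)
    · exact ⟨x.1, 0, 0, rfl, h.symm, Or.inl ⟨rfl, rfl, hne⟩, hoff⟩
    · exact ⟨x.1, 0, 1, rfl, h, Or.inr ⟨zero_ne_one, by rw [heq]⟩, fun i _ => by rw [heq]⟩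
    · exact ⟨y.1, 1, 0, h, rfl, Or.inr ⟨one_ne_zero, by rw [heq]⟩, fun i _ => by rw [heq]⟩

namespace LamplighterGroup

theorem cayleyGraph_adj {x y : LamplighterGroup} :
    cayleyGraph.Adj x y ↔ (x.pos = y.pos ∧ ∀ k, (k ∈ y.lamps ↔ Xor (k ∈ x.lamps) (k = x.pos))) ∨
      (y.pos = x.pos + 1 ∧ x.lamps = y.lamps) ∨ (x.pos = y.pos + 1 ∧ x.lamps = y.lamps) := by
  have hflip : ∀ x y : LamplighterGroup, x * ⟨0, {0}⟩ = y ↔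
      x.pos = y.pos ∧ ∀ k, (k ∈ y.lamps ↔ Xor (k ∈ x.lamps) (k = x.pos)) := by
    intro x y
    rw [mul_def, LamplighterGroup.ext_iff, Finset.ext_iff]
    simp only [add_zero, Finset.mem_symmDiff, mem_map_addLeft, Finset.mem_singleton, sub_eq_zero]
    exact and_congr_right fun _ => forall_congr' fun k => by rw [Xor]; tauto
  have hmove : ∀ (c : ℤ) (x y : LamplighterGroup), x * ⟨c, ∅⟩ = y ↔
      x.pos + c = y.pos ∧ x.lamps = y.lamps := by
    intro c x y
    rw [mul_def, LamplighterGroup.ext_iff, Finset.map_empty, ← Finset.bot_eq_empty, symmDiff_bot]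
  rw [cayleyGraph, SimpleGraph.mulCayley_adj']
  simp only [Set.mem_insert_iff, Set.mem_singleton_iff, exists_eq_or_imp, exists_eq_left,
    eq_comm (a := x) (b := y * _), hflip, hmove]
  constructor
  · rintro ⟨-, (h | ⟨h, hk⟩) | (⟨h, hl⟩ | ⟨h, hl⟩) | ⟨h, hl⟩ | ⟨h, hl⟩⟩
    · exact Or.inl h
    · refine Or.inl ⟨h.symm, fun k => ?_⟩
      rw [hk k, h]
      simp only [Xor]
      tauto
    · exact Or.inr (Or.inl ⟨h.symm, hl⟩)
    · exact Or.inr (Or.inr ⟨h.symm, hl.symm⟩)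
    · exact Or.inr (Or.inr ⟨by omega, hl⟩)
    · exact Or.inr (Or.inl ⟨by omega, hl.symm⟩)
  · intro h
    refine ⟨?_, ?_⟩
    · rintro rfl
      obtain ⟨-, h⟩ | ⟨h, -⟩ | ⟨h, -⟩ := h
      · have := h x.pos
        simp only [Xor] at this
        tauto
      · omega
      · omega
    · obtain h | ⟨h, hl⟩ | ⟨h, hl⟩ := h
      · exact Or.inl (Or.inl h)
      · exact Or.inr (Or.inl (Or.inl ⟨h.symm, hl⟩))
      · exact Or.inr (Or.inl (Or.inr ⟨h.symm, hl.symm⟩))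

/-- The group element with a given position and given lamps, all of them nonnegative. -/
noncomputable def ofLamps (x : ℕ × (ℕ →₀ Fin 2)) : LamplighterGroup :=
  ⟨x.1, x.2.support.map Nat.castEmbedding⟩

theorem mem_lamps_ofLamps {x : ℕ × (ℕ →₀ Fin 2)} {k : ℤ} :
    k ∈ (ofLamps x).lamps ↔ ∃ i : ℕ, x.2 i ≠ 0 ∧ (i : ℤ) = k := by
  simp [ofLamps]

theorem natCast_mem_lamps_ofLamps {x : ℕ × (ℕ →₀ Fin 2)} {i : ℕ} :
    (i : ℤ) ∈ (ofLamps x).lamps ↔ x.2 i ≠ 0 := by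
  simp [ofLamps]

theorem lamps_ofLamps_eq_iff {x y : ℕ × (ℕ →₀ Fin 2)} :
    (ofLamps x).lamps = (ofLamps y).lamps ↔ x.2 = y.2 := by
  refine ⟨fun h => Finsupp.ext fun i => ?_, fun h => by rw [ofLamps, ofLamps, h]⟩
  have h1 : x.2 i ≠ 0 ↔ y.2 i ≠ 0 := by
    rw [← natCast_mem_lamps_ofLamps, ← natCast_mem_lamps_ofLamps, h]
  omega

/-- The lamp graph with the lamplighter rule, embedded into the Cayley graph. -/
noncomputable def lampEmbedding : lampGraph lamplighterRule ↪g cayleyGraph where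
  toFun := ofLamps
  inj' x y h := Prod.ext (Int.ofNat_injective (congrArg pos h))
    (lamps_ofLamps_eq_iff.1 (congrArg lamps h))
  map_rel_iff' := by
    intro x y
    change cayleyGraph.Adj (ofLamps x) (ofLamps y) ↔ _
    rw [cayleyGraph_adj, lampGraph_lamplighterRule_adj, lamps_ofLamps_eq_iff]
    have hpos : ∀ x, (ofLamps x).pos = (x.1 : ℤ) := fun _ => rfl
    simp only [hpos]
    refine or_congr ?_ (or_congr (and_congr_left' (by omega)) (and_congr_left' (by omega)))
    refine and_congr (by omega) ⟨fun h => ⟨?_, fun i hi => ?_⟩, fun ⟨h1, h2⟩ k => ?_⟩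
    · have := h x.1
      rw [natCast_mem_lamps_ofLamps, natCast_mem_lamps_ofLamps] at this
      simp only [Xor] at this
      intro he
      rw [he] at this
      tauto
    · have := h i
      rw [natCast_mem_lamps_ofLamps, natCast_mem_lamps_ofLamps, Nat.cast_inj] at this
      simp only [Xor, hi, not_false_iff, and_true, false_and, or_false] at this
      omega
    · by_cases hk : 0 ≤ k
      · lift k to ℕ using hk
        rw [natCast_mem_lamps_ofLamps, natCast_mem_lamps_ofLamps, Nat.cast_inj]
        by_cases hkx : k = x.1
        · subst hkx
          simp only [Xor, not_true, and_false, true_and, false_or, not_not]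
          omega
        · rw [h2 k hkx]
          simp [Xor, hkx]
      · have hx : ∀ x, k ∉ (ofLamps x).lamps := by
          intro x hx
          obtain ⟨i, -, hi⟩ := mem_lamps_ofLamps.1 hx
          omega
        have hne : k ≠ x.1 := by omega
        simp [Xor, hx, hne]

theorem range_lampEmbedding : Set.range lampEmbedding = positiveSet := by
  ext x
  constructor
  · rintro ⟨y, rfl⟩
    refine ⟨Int.natCast_nonneg _, fun k hk => ?_⟩
    obtain ⟨i, -, rfl⟩ := mem_lamps_ofLamps.1 hk
    exact Int.natCast_nonneg i
  · rintro ⟨hpos, hl⟩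
    refine ⟨(x.pos.toNat, Finsupp.onFinset (x.lamps.image Int.toNat)
      (fun i => if (i : ℤ) ∈ x.lamps then 1 else 0) fun i hi => ?_), ?_⟩
    · refine Finset.mem_image.2 ⟨i, ?_, Int.toNat_natCast i⟩
      by_contra h
      simp [h] at hi
    · change ofLamps _ = x
      refine LamplighterGroup.ext (Int.toNat_of_nonneg hpos) (Finset.ext fun k => ?_)
      rw [mem_lamps_ofLamps]
      simp only [Finsupp.onFinset_apply]
      constructor
      · rintro ⟨i, hi, rfl⟩
        by_contra h
        simp [h] at hi
      · intro hk
        have := Int.toNat_of_nonneg (hl k hk)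
        exact ⟨k.toNat, by rw [this]; simp [hk], this⟩

/-- The positive half of the Cayley graph is the lamp graph with the lamplighter rule. -/
noncomputable def lampGraphIsoPositiveHalf : lampGraph lamplighterRule ≃g positiveHalf :=
  lampEmbedding.isoInduce positiveSet range_lampEmbedding

end LamplighterGroup

/-! ### Percolation at the critical probabilities -/

theorem mainTheorem3 :
    (∀ (α : ℕ) [NeZero α], 2 ≤ α → ∀ o : TreeVertex α × TreeVertex α,
      (diestelLeader o).criticalProb ≤ (dlPositivePart o).criticalProb ∧
      (∀ᵐ ω ∂((dlPositivePart o).percolation (dlPositivePart o).criticalProb),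
        ∀ v, ((dlPositivePart o).cluster ω v).Finite) ∧
      (∀ᵐ ω ∂((dlPositivePart o).percolation (diestelLeader o).criticalProb),
        ∀ v, ((dlPositivePart o).cluster ω v).Finite) ∧
      (∀ᵐ ω ∂((diestelLeader o).percolation (diestelLeader o).criticalProb),
        ∀ x : ℕ → DLVertex o, Function.Injective x →
          (∀ n, ((diestelLeader o).openGraph ω).Adj (x n) (x (n + 1))) →
          (∃ᶠ n in atTop, (x n).level < o.1.level) ∧
          (∃ᶠ n in atTop, o.1.level < (x n).level))) ∧
    LamplighterGroup.cayleyGraph.criticalProb ≤ LamplighterGroup.positiveHalf.criticalProb ∧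
    (∀ᵐ ω ∂(LamplighterGroup.positiveHalf.percolation LamplighterGroup.positiveHalf.criticalProb),
      ∀ v, (LamplighterGroup.positiveHalf.cluster ω v).Finite) := by
  refine ⟨fun α _ hα o => ?_, ?_, ?_⟩
  · have : Nontrivial (Fin α) := Fin.nontrivial_iff_two_le.2 hα
    have hR := preconnected_dlRule (Fin α)
    have hiso := lampGraphIsoDlPositivePart o
    have hle : (diestelLeader o).criticalProb ≤ (dlPositivePart o).criticalProb :=
      SimpleGraph.criticalProb_le_of_embedding (SimpleGraph.Embedding.induce _)
    have hpc := SimpleGraph.criticalProb_congr hiso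
    have hfin : ∀ p, p ≤ (dlPositivePart o).criticalProb →
        ∀ᵐ ω ∂((lampGraph (dlRule (Fin α))).percolation p),
          ∀ v, ((lampGraph (dlRule (Fin α))).cluster ω v).Finite := fun p hp =>
      lampGraph.ae_forall_finite_cluster_of_le_criticalProb hR (hp.trans_eq hpc)
    refine ⟨hle, SimpleGraph.ae_forall_finite_cluster_congr hiso.symm (hfin _ le_rfl),
      SimpleGraph.ae_forall_finite_cluster_congr hiso.symm (hfin _ hle), ?_⟩
    have hall := fun f : lampGraph (dlRule (Fin α)) ↪g diestelLeader o =>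
      SimpleGraph.ae_forall_finite_cluster_of_embedding f (hfin _ hle)
    filter_upwards [ae_all_iff.2 fun u : DLVertex o => hall (dlPositive u),
      ae_all_iff.2 fun u : DLVertex o => hall (dlNegative u)] with ω hpos hneg x hinj hadj
    exact frequently_level_of_forall_finite_cluster hpos hneg hinj hadj o.1.level
  · exact SimpleGraph.criticalProb_le_of_embedding (SimpleGraph.Embedding.induce _)
  · have hiso := LamplighterGroup.lampGraphIsoPositiveHalf
    exact SimpleGraph.ae_forall_finite_cluster_congr hiso.symm
      (lampGraph.ae_forall_finite_cluster_of_le_criticalProb preconnected_lamplighterRule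
        (SimpleGraph.criticalProb_congr hiso).le)
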